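/- Let $f:\mathbb{R}^d\to\mathbb{R}$ be twice continuously differentiable, with gradient $g$ and Hessian $H$, and let $g$ be Lipschitz on $\mathbb{R}^d_+$ with constant $L_g$. For $x\in\mathbb{R}^d$ and $\delta\ge 0$ let $\mathcal{A}(x,\delta)=\{i: 0\le x^i\le\delta\}$ and $\mathcal{I}(x,\delta)=\{i: x^i>\delta\}$; superscripts denote subvectors and principal submatrices, and $\mathcal{P}$ is the projection onto $\mathbb{R}^d_+$. Let $x_*$ be a local minimiser of $f$ over $\mathbb{R}^d_+$ such that $g(x_*)^i>0$ for all $i\in\mathcal{A}(x_*,0)$, and $\langle z,H(x_*)z\rangle>0$ for all $z\ne0$ with $z^i=0$ for $i\in\mathcal{A}(x_*,0)$. Write $\mathcal{I}_*=\mathcal{I}(x_*,0)$. Let $\delta>0$ satisfy $\delta<\frac12 x_*^i$ for all $i\in\mathcal{I}_*$, and let $\rho\in(0,\frac12)$, $\zeta\in(0,1)$. MINRES for $(H,g)$ runs through the iterates $s^{(t)}\in\arg\min\{\|Hs+g\| : s\in\mathrm{span}\{g,Hg,\dots,H^{t-1}g\}\}$, $t=0,1,\dots$, with residuals $r^{(t)}=-g-Hs^{(t)}$.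 It stops at the first $t$ where either $r^{(t)}\neq0$ and $\langle r^{(t)},Hr^{(t)}\rangle\le0$, and then returns $r^{(t)}$ (type NPC), or else an inner termination test holds, and then it returns $s^{(t)}$ (type SOL). The inner test may be any test, and may change with $k$. Newton-MR two-metric projection (local phase version) starts from some $x_0\ge0$ and iterates $x_{k+1}=\mathcal{P}(x_k+\alpha_kp_k)$. With $\mathcal{A}=\mathcal{A}(x_k,\delta)$, $\mathcal{I}=\mathcal{I}(x_k,\delta)$, $g_k=g(x_k)$ and $H_k=H(x_k)$, one sets $p_k^{\mathcal{A}}=-g_k^{\mathcal{A}}$, and $p_k^{\mathcal{I}}$ is the output of MINRES for $(H_k^{\mathcal{I}},g_k^{\mathcal{I}})$. The step length $\alpha_k$ is the first of $1,\zeta,\zeta^2,\dots$ with $$f(\mathcal{P}(x_k+\alpha p_k))-f(x_k)\le\rho\langle g_k^{\mathcal{A}},\mathcal{P}(x_k^{\mathcal{A}}+\alpha p_k^{\mathcal{A}})-x_k^{\mathcal{A}}\rangle+\alpha\rho\langle g_k^{\mathcal{I}},p_k^{\mathcal{I}}\rangle .$$ The method may be stopped at any iterate by an outer termination condition. Let $\hat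 f:\mathbb{R}^{\mathcal{I}_*}\to\mathbb{R}$ be $f$ as a function of the coordinates in $\mathcal{I}_*$, the other coordinates being $0$. Then $x_*^{\mathcal{I}_*}$ is an unconstrained local minimiser of $\hat f$. Moreover there is $\Delta>0$, independent of the sequence of iterates, of the inner tests and of their tolerances, such that whenever $\|x_{\bar k}-x_*\|<\Delta$ for some iterate $x_{\bar k}$ of the method, the following holds. 1. For all $k\ge\bar k+1$, $\mathcal{A}(x_k,\delta)=\mathcal{A}(x_k,0)=\mathcal{A}(x_*,0)$, and $x_k$ vanishes outside $\mathcal{I}_*$. 2. For all $k\ge\bar k+1$, the iteration is a step of unconstrained Newton-MR for $\hat f$: with $y_k=x_k^{\mathcal{I}_*}$ and $q_k=p_k^{\mathcal{I}_*}$, the direction $q_k$ is the output, of type SOL, of MINRES for $(\nabla^2\hat f(y_k),\nabla\hat f(y_k))$ with the same inner test; $\alpha_k$ is the first of $1,\zeta,\zeta^2,\dots$ with $\hat f(y_k+\alpha q_k)-\hat f(y_k)\le\rho\alpha\langle\nabla\hat f(y_k),q_k\rangle$; and $y_{k+1}=y_k+\alpha_kq_k$. 3. Suppose the method is never stopped,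 and let $\eta_k\ge0$. Let the inner test at every iteration $k$ be either (a) the relative residual test $\|r\|\le\eta_k\|g_k^{\mathcal{I}}\|$ or (b) the test $\|H_k^{\mathcal{I}}r\|\le\eta_k\|H_k^{\mathcal{I}}s\|$ (the same one of the two for all $k$). - Suppose that, for all large $k$, $\eta_k\le\bar\eta$ for some $\bar\eta<1$ in case (a), or $\eta_k\le M$ for some $M$ in case (b). Then $x_k\to x_*$, $\alpha_k=1$ for all large $k$, and $\|H(x_*)^{\mathcal{I}_*}(x_{k+1}-x_*)^{\mathcal{I}_*}\|\le q\,\|H(x_*)^{\mathcal{I}_*}(x_k-x_*)^{\mathcal{I}_*}\|$ for all large $k$, where $q$ can be any number $>\bar\eta$ in case (a), and is some number $<1$ in case (b). - If $\eta_k\to0$, then $x_k\to x_*$ superlinearly: $\|x_{k+1}-x_*\|=o(\|x_k-x_*\|)$. - If $\eta_k=O(\|g_k^{\mathcal{I}_*}\|)$, in case (a) also $\eta_k\le\bar\eta<1$ for all large $k$, and $H$ is Lipschitz on $\mathbb{R}^d_+$ near $x_*$, then $x_k\to x_*$ quadratically: $\|x_{k+1}-x_*\|=O(\|x_k-x_*\|^2)$.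 -/

import Mathlib

open Filter Topology Asymptotics

noncomputable section

namespace NewtonMR

/-- The two kinds of direction that MINRES can return. -/
inductive StepType
  | SOL
  | NPC

section Unconstrained

variable {V : Type*} [NormedAddCommGroup V] [InnerProductSpace ℝ V]

/-- The Krylov subspace `span {g, H g, …, H ^ (t - 1) g}`. -/
def krylov (H : V →L[ℝ] V) (g : V) (t : ℕ) : Submodule ℝ V :=
  Submodule.span ℝ (Set.range fun i : Fin t => (H ^ (i : ℕ)) g)

/-- The residual `r = - g - H s` of the Newton system `H s = - g`. -/
def residual (H : V →L[ℝ] V) (g s : V) : V := -g - H s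

/-- `s` is a `t`-th MINRES iterate: a minimiser of `‖H s + g‖` over the `t`-th Krylov subspace. -/
def IsMINRESIterate (H : V →L[ℝ] V) (g : V) (t : ℕ) (s : V) : Prop :=
  s ∈ krylov H g t ∧ ∀ v ∈ krylov H g t, ‖H s + g‖ ≤ ‖H v + g‖

/-- The (nonzero) direction `r` has curvature at most `ϑ`. -/
def IsNPC (H : V →L[ℝ] V) (ϑ : ℝ) (r : V) : Prop :=
  r ≠ 0 ∧ inner ℝ r (H r) ≤ ϑ * ‖r‖ ^ 2

/-- MINRES for `H`, `g` with inner termination test `halt` and curvature tolerance `ϑ` returns the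
direction `p`, of type `D`. The iterates are visited in the order `0, 1, 2, …`; at each of them the
curvature of the residual is checked first, and the termination test second. -/
def MINRESReturns (H : V →L[ℝ] V) (g : V) (halt : V → Prop) (ϑ : ℝ) (p : V) (D : StepType) :
    Prop :=
  ∃ (s : ℕ → V) (t : ℕ),
    (∀ i ≤ t, IsMINRESIterate H g i (s i)) ∧
    (∀ i < t, ¬ IsNPC H ϑ (residual H g (s i)) ∧ ¬ halt (s i)) ∧
    ((D = StepType.NPC ∧ IsNPC H ϑ (residual H g (s t)) ∧ p = residual H g (s t)) ∨
      (D = StepType.SOL ∧ ¬ IsNPC H ϑ (residual H g (s t)) ∧ halt (s t) ∧ p = s t))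

/-- Backtracking from the unit step with factor `ζ` returns `α`: it is the first of the numbers
`1, ζ, ζ ^ 2, …` that satisfies the criterion. -/
def BacktrackingReturns (crit : ℝ → Prop) (ζ α : ℝ) : Prop :=
  ∃ m : ℕ, α = ζ ^ m ∧ crit (ζ ^ m) ∧ ∀ j < m, ¬ crit (ζ ^ j)

variable [CompleteSpace V]

/-- The Hessian of `F` at `y`, as a linear operator. -/
def hessian (F : V → ℝ) (y : V) : V →L[ℝ] V := fderiv ℝ (gradient F) y

/-- One step of (unconstrained) Newton-MR for `F`, from `y` to `y'`: the direction `p`, of type `D`,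
comes from MINRES applied to the Hessian and the gradient of `F` at `y`, and the step length `α`
from backtracking on the Armijo condition. -/
def IsNewtonMRStep (F : V → ℝ) (ρ ζ : ℝ) (test : (V →L[ℝ] V) → V → V → Prop)
    (y p : V) (D : StepType) (α : ℝ) (y' : V) : Prop :=
  MINRESReturns (hessian F y) (gradient F y) (test (hessian F y) (gradient F y)) 0 p D ∧
  BacktrackingReturns
    (fun a => F (y + a • p) - F y ≤ ρ * (a * inner ℝ (gradient F y) p)) ζ α ∧
  y' = y + α • p

end Unconstrained

section Constrained

variable {d : ℕ}

/-- The nonnegative orthant. -/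
def orthant (d : ℕ) : Set (EuclideanSpace ℝ (Fin d)) := {x | ∀ i, 0 ≤ x i}

/-- The orthogonal projection onto the nonnegative orthant. -/
def proj (x : EuclideanSpace ℝ (Fin d)) : EuclideanSpace ℝ (Fin d) :=
  WithLp.toLp 2 fun i => max (x i) 0

open Classical in
/-- The `δ`-active set. -/
def active (x : EuclideanSpace ℝ (Fin d)) (δ : ℝ) : Finset (Fin d) :=
  Finset.univ.filter fun i => 0 ≤ x i ∧ x i ≤ δ

open Classical in
/-- The `δ`-inactive set. -/
def inactive (x : EuclideanSpace ℝ (Fin d)) (δ : ℝ) : Finset (Fin d) :=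
  Finset.univ.filter fun i => δ < x i

/-- The subvector of `x` with the components in `I`. -/
def subvec (I : Finset (Fin d)) : EuclideanSpace ℝ (Fin d) →L[ℝ] EuclideanSpace ℝ I :=
  LinearMap.toContinuousLinearMap
    { toFun := fun x => WithLp.toLp 2 fun i => x i.1
      map_add' := fun x y => by ext i; simp
      map_smul' := fun c x => by ext i; simp }

/-- The vector with components `y` on `I` and zeros elsewhere. -/
def pad (I : Finset (Fin d)) : EuclideanSpace ℝ I →L[ℝ] EuclideanSpace ℝ (Fin d) :=
  LinearMap.toContinuousLinearMap
    { toFun := fun y => WithLp.toLp 2 fun i => if h : i ∈ I then y ⟨i, h⟩ else 0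
      map_add' := fun x y => by ext i; by_cases h : i ∈ I <;> simp [h]
      map_smul' := fun c x => by ext i; by_cases h : i ∈ I <;> simp [h] }

/-- The principal submatrix of `H` with rows and columns in `I`, as an operator. -/
def submat (I : Finset (Fin d)) (H : EuclideanSpace ℝ (Fin d) →L[ℝ] EuclideanSpace ℝ (Fin d)) :
    EuclideanSpace ℝ I →L[ℝ] EuclideanSpace ℝ I :=
  (subvec I).comp (H.comp (pad I))

/-- `f` as a function of the coordinates in `I`, the other coordinates being zero. -/
def restrictTo (f : EuclideanSpace ℝ (Fin d) → ℝ) (I : Finset (Fin d)) : EuclideanSpace ℝ I → ℝ :=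
  fun y => f (pad I y)

/-- An inner termination test: for each index set, a condition on the Hessian, the gradient and the
current MINRES iterate on these coordinates. -/
abbrev InnerTest (d : ℕ) : Type :=
  ∀ I : Finset (Fin d), (EuclideanSpace ℝ I →L[ℝ] EuclideanSpace ℝ I) →
    EuclideanSpace ℝ I → EuclideanSpace ℝ I → Prop

/-- The test `‖H r‖ ≤ η ‖H s‖`. -/
def normalTest (η : ℝ) : InnerTest d :=
  fun _ H g s => ‖H (residual H g s)‖ ≤ η * ‖H s‖

/-- The relative residual test `‖r‖ ≤ η ‖g‖`. -/
def relativeTest (η : ℝ) : InnerTest d :=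
  fun _ H g s => ‖residual H g s‖ ≤ η * ‖g‖

/-- The line search criterion of the two-metric projection method. -/
def LineSearchCriterion (f : EuclideanSpace ℝ (Fin d) → ℝ) (ρ δ : ℝ)
    (x p : EuclideanSpace ℝ (Fin d)) (a : ℝ) : Prop :=
  f (proj (x + a • p)) - f x ≤
    ρ * inner ℝ (subvec (active x δ) (gradient f x))
        (subvec (active x δ) (proj (x + a • p)) - subvec (active x δ) x) +
      a * ρ * inner ℝ (subvec (inactive x δ) (gradient f x)) (subvec (inactive x δ) p)

/-- One iteration of Newton-MR two-metric projection (local phase version) from `x` to `x'`: a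
gradient direction in the active set, a MINRES direction of type `D` in the inactive set,
backtracking from the unit step, and projection. -/
def IsLocalPhaseStep (f : EuclideanSpace ℝ (Fin d) → ℝ) (ρ ζ δ : ℝ) (test : InnerTest d)
    (x p : EuclideanSpace ℝ (Fin d)) (D : StepType) (α : ℝ)
    (x' : EuclideanSpace ℝ (Fin d)) : Prop :=
  subvec (active x δ) p = -subvec (active x δ) (gradient f x) ∧
  MINRESReturns (submat (inactive x δ) (hessian f x)) (subvec (inactive x δ) (gradient f x))
    (test (inactive x δ) (submat (inactive x δ) (hessian f x))
      (subvec (inactive x δ) (gradient f x))) 0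
    (subvec (inactive x δ) p) D ∧
  BacktrackingReturns (LineSearchCriterion f ρ δ x p) ζ α ∧
  x' = proj (x + α • p)

/-- The iterates `x`, directions `p`, direction types `D` and step lengths `α` are produced by the
local phase version of Newton-MR two-metric projection, started at a feasible point. The inner
termination test may change from iteration to iteration; `K` is the index of the iterate at which
the outer termination condition stops the method (`⊤` if it never does). -/
structure IsLocalPhaseRun (f : EuclideanSpace ℝ (Fin d) → ℝ) (ρ ζ δ : ℝ) (test : ℕ → InnerTest d)
    (K : ℕ∞) (x p : ℕ → EuclideanSpace ℝ (Fin d)) (D : ℕ → StepType) (α : ℕ → ℝ) : Prop where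
  start : x 0 ∈ orthant d
  step : ∀ k : ℕ, (k : ℕ∞) < K →
    IsLocalPhaseStep f ρ ζ δ (test k) (x k) (p k) (D k) (α k) (x (k + 1))

/-- The multipliers of the active constraints at `x` are positive. -/
def Nondegenerate (f : EuclideanSpace ℝ (Fin d) → ℝ) (x : EuclideanSpace ℝ (Fin d)) : Prop :=
  ∀ i ∈ active x 0, 0 < gradient f x i

/-- The second-order sufficiency condition at `x`. -/
def SecondOrderSufficient (f : EuclideanSpace ℝ (Fin d) → ℝ) (x : EuclideanSpace ℝ (Fin d)) :
    Prop :=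
  ∀ z : EuclideanSpace ℝ (Fin d), z ≠ 0 → (∀ i ∈ active x 0, z i = 0) →
    0 < inner ℝ z (hessian f x z)

end Constrained

end NewtonMR

end

/-!
Near `xs` every iteration of the method takes the unit step, whatever the inner test is.

On the inactive coordinates `I` the Hessian is coercive near `xs`. For a coercive operator the
MINRES residual `r = -g - H s` satisfies `⟪s, r⟫ ≥ 0` at every iterate
(`inner_iterate_residual_nonneg`): an increment of the iterates has the form `c • g + H w` with
`c ≤ 0` and `w` in the previous Krylov subspace, while later residuals are orthogonal to `H w` and
have inner product `-‖r‖ ^ 2` with `g`. Thus `⟪g, s⟫ ≤ -⟪s, H s⟫`, the quadratic model decreases by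
at least `-⟪g, s⟫ / 2`, and as `ρ < 1 / 2` the Armijo condition holds at the unit step once the
Taylor remainder is small. The active coordinates are projected to zero; there the positive
multipliers give a first-order decrease which outweighs all second-order terms involving these
coordinates (`LocalModel.sufficient_decrease`). So one step identifies the active set, and on the
resulting face of the orthant the method is unconstrained Newton-MR. As `f` decreases and grows
quadratically on the face, the iterates are trapped in a small ball (`LocalModel.Trapped.step`),
uniformly in the inner tests.

Each inner test yields an inexact Newton condition `‖r‖ ≤ θ ‖g‖`. For the normal-equation test,
the zero iterate is accepted only if the gradient vanishes, so at least one minimal residual step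
is made, which gives a fixed `θ < 1`; moreover the test gives `θ` proportional to its tolerance.
If `θ` is bounded away from one, then `‖xₖ - xs‖` is bounded by a multiple of `‖sₖ‖`, and the sum
of the decreases of `f` is finite, so the iterates converge (`IsTail.tendsto`). The rates follow
from the identity `H⋆ (xₖ₊₁ - xs) = -r + (H⋆ (xₖ - xs) - g) + (H⋆ - Hₖ) sₖ` on the face, where
`H⋆` is the Hessian at `xs`.
-/

/-! ### MINRES for a coercive operator -/

namespace NewtonMR

section Krylov

variable {V : Type*} [NormedAddCommGroup V] [InnerProductSpace ℝ V] {H : V →L[ℝ] V} {g : V}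

theorem krylov_mono {i j : ℕ} (h : i ≤ j) : krylov H g i ≤ krylov H g j := by
  refine Submodule.span_mono ?_
  rintro _ ⟨a, rfl⟩
  exact ⟨⟨a, a.2.trans_le h⟩, rfl⟩

/-- The Krylov subspaces satisfy `K (t + 1) = span {g} + H (K t)`; this is the nontrivial
inclusion. -/
theorem exists_of_mem_krylov_succ {t : ℕ} {v : V} (hv : v ∈ krylov H g (t + 1)) :
    ∃ c : ℝ, ∃ w ∈ krylov H g t, v = c • g + H w := by
  induction hv using Submodule.span_induction with
  | mem x hx =>
    obtain ⟨⟨i, hi⟩, rfl⟩ := hx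
    cases i with
    | zero => exact ⟨1, 0, zero_mem _, by simp⟩
    | succ i =>
      refine ⟨0, (H ^ i) g, Submodule.subset_span ⟨⟨i, by omega⟩, rfl⟩, ?_⟩
      simp [pow_succ']
  | zero => exact ⟨0, 0, zero_mem _, by simp⟩
  | add x y _ _ hx hy =>
    obtain ⟨c, w, hw, rfl⟩ := hx
    obtain ⟨c', w', hw', rfl⟩ := hy
    exact ⟨c + c', w + w', add_mem hw hw', by rw [map_add, add_smul]; abel⟩
  | smul a x _ hx =>
    obtain ⟨c, w, hw, rfl⟩ := hx
    exact ⟨a * c, a • w, Submodule.smul_mem _ _ hw, by rw [map_smul, smul_add, mul_smul]⟩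

/-- The normal equations of the MINRES subproblem. -/
theorem IsMINRESIterate.inner_residual_eq_zero {t : ℕ} {s v : V} (hs : IsMINRESIterate H g t s)
    (hv : v ∈ krylov H g t) : inner ℝ (residual H g s) (H v) = 0 := by
  have key : ∀ a : ℝ, 0 ≤ 2 * a * -inner ℝ (residual H g s) (H v) + a ^ 2 * ‖H v‖ ^ 2 := by
    intro a
    have h1 := hs.2 (s + a • v) (add_mem hs.1 (Submodule.smul_mem _ a hv))
    have h2 : H (s + a • v) + g = -residual H g s + a • H v := by
      simp only [residual, map_add, map_smul]; abel
    have h3 : H s + g = -residual H g s := by simp only [residual]; abel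
    rw [h2, h3] at h1
    have h4 := pow_le_pow_left₀ (norm_nonneg _) h1 2
    rw [norm_add_sq_real, inner_smul_right, inner_neg_left, norm_smul, mul_pow,
      Real.norm_eq_abs, sq_abs] at h4
    linarith
  by_contra hne
  set b := inner ℝ (residual H g s) (H v)
  -- the quadratic above is negative at `a = b / (‖H v‖ ^ 2 + 1)`
  have hp : 0 < ‖H v‖ ^ 2 + 1 := by positivity
  have h := key (b / (‖H v‖ ^ 2 + 1))
  have hb : 0 < b ^ 2 := by positivity
  have h5 : 2 * (b / (‖H v‖ ^ 2 + 1)) * -b + (b / (‖H v‖ ^ 2 + 1)) ^ 2 * ‖H v‖ ^ 2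
      = -(b ^ 2 * (‖H v‖ ^ 2 + 2)) / (‖H v‖ ^ 2 + 1) ^ 2 := by
    field_simp; ring
  rw [h5, neg_div] at h
  have : 0 < b ^ 2 * (‖H v‖ ^ 2 + 2) / (‖H v‖ ^ 2 + 1) ^ 2 := by positivity
  linarith

theorem IsMINRESIterate.inner_residual_gradient {t : ℕ} {s : V} (hs : IsMINRESIterate H g t s) :
    inner ℝ (residual H g s) g = -‖residual H g s‖ ^ 2 := by
  have h := hs.inner_residual_eq_zero hs.1
  have hg : g = -residual H g s - H s := by simp only [residual]; abel
  calc inner ℝ (residual H g s) g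
      = inner ℝ (residual H g s) (-residual H g s - H s) := by rw [← hg]
    _ = _ := by rw [inner_sub_right, inner_neg_right, h, real_inner_self_eq_norm_sq]; ring

theorem IsMINRESIterate.norm_residual_le {t : ℕ} {s : V} (hs : IsMINRESIterate H g t s) :
    ‖residual H g s‖ ≤ ‖g‖ := by
  have h := hs.2 0 (zero_mem _)
  have h3 : residual H g s = -(H s + g) := by simp only [residual]; abel
  rw [h3, norm_neg]
  simpa using h

section Coercive

variable {μ : ℝ} (hμ : 0 < μ) (hH : ∀ v, μ * ‖v‖ ^ 2 ≤ inner ℝ v (H v))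
include hH

theorem norm_le_of_coercive (v : V) : μ * ‖v‖ ≤ ‖H v‖ := by
  by_cases h : ‖v‖ = 0
  · rw [h]; simp
  have hv : 0 < ‖v‖ := lt_of_le_of_ne (norm_nonneg _) (Ne.symm h)
  have := (hH v).trans (real_inner_le_norm v (H v))
  nlinarith

include hμ

theorem not_isNPC_of_coercive (r : V) : ¬ IsNPC H 0 r := by
  rintro ⟨h0, h⟩
  have := norm_pos_iff.2 h0
  have := hH r
  have : 0 < μ * ‖r‖ ^ 2 := by positivity
  linarith

/-- The increment of two consecutive MINRES iterates is `c • g + H w` with `c ≤ 0`: the coefficient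
is determined by `⟪Δ, H Δ⟫ = -c ‖H Δ‖ ^ 2`. -/
theorem inner_increment_residual_nonneg {t j : ℕ} (htj : t < j) {s s' sj : V}
    (hs : IsMINRESIterate H g t s) (hs' : IsMINRESIterate H g (t + 1) s')
    (hj : IsMINRESIterate H g j sj) : 0 ≤ inner ℝ (s' - s) (residual H g sj) := by
  have hmem : s' - s ∈ krylov H g (t + 1) := sub_mem hs'.1 (krylov_mono t.le_succ hs.1)
  obtain ⟨c, w, hw, hcw⟩ := exists_of_mem_krylov_succ hmem
  have hHd : H (s' - s) = residual H g s - residual H g s' := by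
    simp only [residual, map_sub]; abel
  have hw0 : inner ℝ (H w) (H (s' - s)) = 0 := by
    rw [real_inner_comm, hHd, inner_sub_left, hs.inner_residual_eq_zero hw,
      hs'.inner_residual_eq_zero (krylov_mono t.le_succ hw), sub_zero]
  have hg : inner ℝ g (H (s' - s)) = -‖H (s' - s)‖ ^ 2 := by
    have h1 := hs'.inner_residual_eq_zero hmem
    have h2 : inner ℝ (H s) (H (s' - s)) = 0 := by
      rw [real_inner_comm, hHd, inner_sub_left, hs.inner_residual_eq_zero hs.1,
        hs'.inner_residual_eq_zero (krylov_mono t.le_succ hs.1), sub_zero]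
    have h3 : g = -residual H g s' - (H (s' - s) + H s) := by
      simp only [residual, map_sub]; abel
    calc inner ℝ g (H (s' - s))
        = inner ℝ (-residual H g s' - (H (s' - s) + H s)) (H (s' - s)) := by rw [← h3]
      _ = _ := by
        rw [inner_sub_left, inner_neg_left, inner_add_left, h1, h2, real_inner_self_eq_norm_sq]
        ring
  have hq : inner ℝ (s' - s) (H (s' - s)) = -c * ‖H (s' - s)‖ ^ 2 := by
    calc inner ℝ (s' - s) (H (s' - s)) = inner ℝ (c • g + H w) (H (s' - s)) := by rw [← hcw]
      _ = _ := by rw [inner_add_left, inner_smul_left, hg, hw0]; simp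
  have hr : inner ℝ (s' - s) (residual H g sj) = -c * ‖residual H g sj‖ ^ 2 := by
    calc inner ℝ (s' - s) (residual H g sj) = inner ℝ (c • g + H w) (residual H g sj) := by
          rw [← hcw]
      _ = _ := by
        rw [inner_add_left, inner_smul_left, real_inner_comm _ g, hj.inner_residual_gradient,
          real_inner_comm _ (H w), hj.inner_residual_eq_zero (krylov_mono htj.le hw)]
        simp
  rw [hr]
  by_cases h0 : s' - s = 0
  · rw [h0] at hr; rw [← hr]; simp
  · have h1 : 0 < ‖s' - s‖ := norm_pos_iff.2 h0
    have h2 := norm_le_of_coercive hH (s' - s)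
    have h3 : 0 < ‖H (s' - s)‖ := lt_of_lt_of_le (by positivity) h2
    have h4 : 0 < inner ℝ (s' - s) (H (s' - s)) := lt_of_lt_of_le (by positivity) (hH _)
    rw [hq] at h4
    have h5 : 0 < -c := pos_of_mul_pos_left h4 (by positivity)
    positivity

/-- A MINRES iterate is the sum of the earlier increments, each of which has a nonnegative inner
product with the current residual. -/
theorem inner_iterate_residual_nonneg {t : ℕ} {s : ℕ → V}
    (hs : ∀ i ≤ t, IsMINRESIterate H g i (s i)) : 0 ≤ inner ℝ (s t) (residual H g (s t)) := by
  have key : ∀ i ≤ t, 0 ≤ inner ℝ (s i) (residual H g (s t)) := by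
    intro i
    induction i with
    | zero =>
      intro _
      have h := (hs 0 (Nat.zero_le _)).1
      have h0 : s 0 = 0 := by simpa [krylov] using h
      rw [h0]; simp
    | succ i ih =>
      intro hi
      have h := inner_increment_residual_nonneg hμ hH (Nat.lt_of_succ_le hi) (hs i (by omega))
        (hs (i + 1) hi) (hs t le_rfl)
      rw [inner_sub_left] at h
      linarith [ih (by omega)]
  exact key t le_rfl

/-- A single MINRES step, that is, one minimal residual step along `g`, reduces the residual by a
factor that depends only on the bounds for `H`. -/
theorem norm_residual_sq_le_of_one_le {L : ℝ} (hL : 0 < L) (hHL : ‖H‖ ≤ L) {t : ℕ} (ht : 1 ≤ t)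
    {s : V} (hs : IsMINRESIterate H g t s) :
    ‖residual H g s‖ ^ 2 ≤ (1 - (μ / L) ^ 2) * ‖g‖ ^ 2 := by
  have hg : g ∈ krylov H g t := Submodule.subset_span ⟨⟨0, ht⟩, by simp⟩
  have h := hs.2 (-(μ / L ^ 2) • g) (Submodule.smul_mem _ _ hg)
  have h3 : residual H g s = -(H s + g) := by simp only [residual]; abel
  rw [h3, norm_neg]
  refine (pow_le_pow_left₀ (norm_nonneg _) h 2).trans ?_
  rw [map_smul, add_comm, norm_add_sq_real, inner_smul_right, norm_smul, mul_pow,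
      Real.norm_eq_abs, sq_abs]
  have h1 := hH g
  have h2 : ‖H g‖ ^ 2 ≤ L ^ 2 * ‖g‖ ^ 2 := by
    rw [← mul_pow]
    exact pow_le_pow_left₀ (norm_nonneg _) ((H.le_opNorm g).trans (by gcongr)) 2
  have h4 : (-(μ / L ^ 2)) ^ 2 * ‖H g‖ ^ 2 ≤ (-(μ / L ^ 2)) ^ 2 * (L ^ 2 * ‖g‖ ^ 2) := by gcongr
  have h5 : μ / L ^ 2 * (μ * ‖g‖ ^ 2) ≤ μ / L ^ 2 * inner ℝ g (H g) := by gcongr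
  have h6 : (-(μ / L ^ 2)) ^ 2 * (L ^ 2 * ‖g‖ ^ 2) = (μ / L) ^ 2 * ‖g‖ ^ 2 := by field_simp
  have h7 : μ / L ^ 2 * (μ * ‖g‖ ^ 2) = (μ / L) ^ 2 * ‖g‖ ^ 2 := by field_simp
  linarith

/-- What MINRES guarantees for a coercive operator, whatever the inner termination test: the
output is of type SOL and satisfies the test, it is a descent direction with
`⟪g, p⟫ ≤ -⟪p, H p⟫`, and unless it is zero it reduces the residual by a fixed factor. -/
theorem MINRESReturns.of_coercive {L : ℝ} (hL : 0 < L) (hHL : ‖H‖ ≤ L) {halt : V → Prop} {p : V}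
    {D : StepType} (h : MINRESReturns H g halt 0 p D) :
    D = StepType.SOL ∧ halt p ∧ inner ℝ g p ≤ -inner ℝ p (H p) ∧
      ‖residual H g p‖ ≤ ‖g‖ ∧
      (p = 0 ∨ ‖residual H g p‖ ^ 2 ≤ (1 - (μ / L) ^ 2) * ‖g‖ ^ 2) := by
  obtain ⟨s, t, hs, -, (⟨-, hn, -⟩ | ⟨hD, -, hh, rfl⟩)⟩ := h
  · exact absurd hn (not_isNPC_of_coercive hμ hH _)
  refine ⟨hD, hh, ?_, (hs t le_rfl).norm_residual_le, ?_⟩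
  · have h1 := inner_iterate_residual_nonneg hμ hH hs
    rw [residual, inner_sub_right, inner_neg_right, real_inner_comm] at h1
    linarith
  · rcases Nat.eq_zero_or_pos t with rfl | ht
    · left
      simpa [krylov] using (hs 0 le_rfl).1
    · right
      exact norm_residual_sq_le_of_one_le hμ hH hL hHL ht (hs t le_rfl)

omit hμ hH in
theorem norm_map_le_of_norm_residual_le {p : V} (h : ‖residual H g p‖ ≤ ‖g‖) :
    ‖H p‖ ≤ 2 * ‖g‖ := by
  have h1 : H p = -g - residual H g p := by simp only [residual]; abel
  rw [h1]
  refine (norm_sub_le _ _).trans ?_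
  rw [norm_neg]; linarith

theorem norm_le_of_norm_residual_le {p : V} (h : ‖residual H g p‖ ≤ ‖g‖) :
    ‖p‖ ≤ 2 / μ * ‖g‖ := by
  have h1 := norm_le_of_coercive hH p
  have h2 := norm_map_le_of_norm_residual_le h
  rw [div_mul_eq_mul_div, le_div_iff₀ hμ]
  linarith

/-- The normal-equation residual test cannot hold at the zero iterate unless the gradient vanishes;
hence it always yields a fixed reduction of the residual. -/
theorem norm_residual_le_of_normalTest {L : ℝ} {p : V} {η : ℝ}
    (ht : ‖H (residual H g p)‖ ≤ η * ‖H p‖)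
    (h : p = 0 ∨ ‖residual H g p‖ ^ 2 ≤ (1 - (μ / L) ^ 2) * ‖g‖ ^ 2) :
    ‖residual H g p‖ ≤ √(1 - (μ / L) ^ 2) * ‖g‖ := by
  rcases h with rfl | h
  · have h1 : ‖H (residual H g 0)‖ ≤ 0 := by simpa using ht
    have h2 := norm_le_of_coercive hH (residual H g 0)
    have h3 : ‖residual H g 0‖ ≤ 0 := by
      by_contra hc
      have : 0 < μ * ‖residual H g 0‖ := mul_pos hμ (not_le.1 hc)
      linarith
    exact h3.trans (by positivity)
  · rcases le_or_gt 0 (1 - (μ / L) ^ 2) with h0 | h0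
    · refine Real.le_sqrt_of_sq_le h |>.trans ?_
      rw [Real.sqrt_mul h0, Real.sqrt_sq (norm_nonneg _)]
    · have h1 : ‖residual H g p‖ ^ 2 ≤ 0 := h.trans
        (mul_nonpos_of_nonpos_of_nonneg h0.le (by positivity))
      have h2 : ‖residual H g p‖ = 0 := by
        have := sq_nonneg ‖residual H g p‖
        exact pow_eq_zero_iff (two_ne_zero) |>.1 (le_antisymm h1 this)
      rw [h2]; positivity

theorem norm_residual_le_mul_of_normalTest {p : V} {η : ℝ} (hη : 0 ≤ η)
    (ht : ‖H (residual H g p)‖ ≤ η * ‖H p‖) (h : ‖residual H g p‖ ≤ ‖g‖) :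
    ‖residual H g p‖ ≤ 2 / μ * η * ‖g‖ := by
  have h1 := norm_le_of_coercive hH (residual H g p)
  have h2 := mul_le_mul_of_nonneg_left (norm_map_le_of_norm_residual_le h) hη
  rw [mul_assoc, div_mul_eq_mul_div, le_div_iff₀ hμ]
  linarith

end Coercive

end Krylov

end NewtonMR

/-! ### Gradients and Hessians -/

namespace NewtonMR

section Gradient

variable {V : Type*} [NormedAddCommGroup V] [InnerProductSpace ℝ V] [CompleteSpace V] {F : V → ℝ}

/-- The Riesz representation as a linear (rather than conjugate-linear) map over the reals. -/
noncomputable def rieszCLM (V : Type*) [NormedAddCommGroup V] [InnerProductSpace ℝ V] [CompleteSpace V] :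
    StrongDual ℝ V →L[ℝ] V :=
  LinearMap.mkContinuous
    { toFun := (InnerProductSpace.toDual ℝ V).symm
      map_add' := map_add _
      map_smul' := fun c l => by simp } 1 fun l => by simp

theorem contDiff_gradient (hF : ContDiff ℝ 2 F) : ContDiff ℝ 1 (gradient F) :=
  (rieszCLM V).contDiff.comp (hF.fderiv_right (m := 1) (by norm_num))

theorem hasFDerivAt_gradient (hF : ContDiff ℝ 2 F) (y : V) :
    HasFDerivAt (gradient F) (hessian F y) y :=
  ((contDiff_gradient hF).differentiable (by norm_num) y).hasFDerivAt

/-- The second derivative as a bilinear form is represented by the Hessian operator. -/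
theorem fderiv_fderiv_apply (hF : ContDiff ℝ 2 F) (y u v : V) :
    fderiv ℝ (fderiv ℝ F) y u v = inner ℝ (hessian F y u) v := by
  have h1 := hasFDerivAt_gradient hF y
  have h2 : fderiv ℝ F = fun z => innerSL ℝ (gradient F z) := by
    funext z
    ext w
    simp [inner_gradient_left]
  have h3 := ((innerSL ℝ : V →L[ℝ] V →L[ℝ] ℝ).hasFDerivAt (x := gradient F y)).comp y h1
  rw [h2]
  have h4 := h3.fderiv
  simp only [Function.comp_def] at h4
  rw [h4]
  rfl

theorem hessian_symm (hF : ContDiff ℝ 2 F) (y u v : V) :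
    inner ℝ (hessian F y u) v = inner ℝ u (hessian F y v) := by
  have h := (hF.contDiffAt (x := y)).isSymmSndFDerivAt (by simp) u v
  rw [fderiv_fderiv_apply hF, fderiv_fderiv_apply hF] at h
  rw [h, real_inner_comm]

theorem continuous_hessian (hF : ContDiff ℝ 2 F) : Continuous (hessian F) :=
  (contDiff_gradient hF).continuous_fderiv (by norm_num)

theorem norm_gradient_sub_sub_le (hF : ContDiff ℝ 2 F) {s : Set V} (hs : Convex ℝ s)
    {A : V →L[ℝ] V} {ε : ℝ} (hA : ∀ z ∈ s, ‖hessian F z - A‖ ≤ ε) {x z : V} (hx : x ∈ s)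
    (hz : z ∈ s) : ‖gradient F z - gradient F x - A (z - x)‖ ≤ ε * ‖z - x‖ :=
  hs.norm_image_sub_le_of_norm_hasFDerivWithin_le'
    (fun w _ => (hasFDerivAt_gradient hF w).hasFDerivWithinAt) hA hx hz

/-- Second-order Taylor expansion with a fixed symmetric operator `A` close to the Hessian; the
base point `x` may vary. -/
theorem abs_taylor_le (hF : ContDiff ℝ 2 F) {s : Set V} (hs : Convex ℝ s)
    {A : V →L[ℝ] V} (hsymm : ∀ u v, inner ℝ (A u) v = inner ℝ u (A v)) {ε : ℝ}
    (hA : ∀ z ∈ s, ‖hessian F z - A‖ ≤ ε) {x z : V} (hx : x ∈ s) (hz : z ∈ s) :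
    |F z - F x - inner ℝ (gradient F x) (z - x) - 1 / 2 * inner ℝ (z - x) (A (z - x))| ≤
      ε * ‖z - x‖ ^ 2 := by
  have hε : 0 ≤ ε := (norm_nonneg _).trans (hA x hx)
  let φ : V → ℝ := fun w =>
    F w - inner ℝ (gradient F x) (w - x) - 1 / 2 * inner ℝ (w - x) (A (w - x))
  have hφ : ∀ w, HasFDerivAt φ
      (innerSL ℝ (gradient F w - gradient F x - A (w - x))) w := by
    intro w
    have h1 : HasFDerivAt F (fderiv ℝ F w) w :=
      ((hF.differentiable (by norm_num)) w).hasFDerivAt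
    have h2 : HasFDerivAt (fun w => w - x) (ContinuousLinearMap.id ℝ V) w :=
      (hasFDerivAt_id w).sub_const x
    have h3 : HasFDerivAt (fun w => inner ℝ (gradient F x) (w - x))
        ((innerSL ℝ (gradient F x)).comp (ContinuousLinearMap.id ℝ V)) w :=
      ((innerSL ℝ (gradient F x)).hasFDerivAt).comp w h2
    have h4 := (h2.inner ℝ (A.hasFDerivAt.comp w h2)).const_mul (1 / 2 : ℝ)
    refine ((h1.sub h3).sub h4).congr_fderiv ?_
    ext v
    have h5 := hsymm (w - x) v
    simp only [sub_apply, ContinuousLinearMap.comp_apply,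
      ContinuousLinearMap.id_apply, innerSL_apply_apply, smul_apply,
      ContinuousLinearMap.prod_apply, fderivInnerCLM_apply, Function.comp_apply, smul_eq_mul,
      inner_sub_left (𝕜 := ℝ) (gradient F w), inner_sub_left (𝕜 := ℝ) (gradient F w - gradient F x),
      inner_gradient_left, real_inner_comm (A (w - x)) v] at h5 ⊢
    rw [h5]
    ring
  have hbound : ∀ w ∈ segment ℝ x z,
      ‖innerSL ℝ (gradient F w - gradient F x - A (w - x))‖ ≤ ε * ‖z - x‖ := by
    intro w hw
    rw [innerSL_apply_norm]
    refine (norm_gradient_sub_sub_le hF hs hA hx (hs.segment_subset hx hz hw)).trans ?_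
    gcongr
    exact norm_sub_le_of_mem_segment hw
  have h := (convex_segment x z).norm_image_sub_le_of_norm_hasFDerivWithin_le
    (fun w _ => (hφ w).hasFDerivWithinAt) hbound (left_mem_segment ℝ x z)
    (right_mem_segment ℝ x z)
  have h6 : φ z - φ x =
      F z - F x - inner ℝ (gradient F x) (z - x) - 1 / 2 * inner ℝ (z - x) (A (z - x)) := by
    simp only [φ, sub_self, map_zero, inner_zero_right]; ring
  rw [h6, Real.norm_eq_abs] at h
  rw [sq, ← mul_assoc]
  exact h

end Gradient

/-! ### Subvectors and restrictions -/

section Coordinates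

variable {d : ℕ} {I : Finset (Fin d)}

@[simp]
theorem subvec_apply (x : EuclideanSpace ℝ (Fin d)) (i : I) : subvec I x i = x i.1 := rfl

theorem pad_apply (y : EuclideanSpace ℝ I) (i : Fin d) :
    pad I y i = if h : i ∈ I then y ⟨i, h⟩ else 0 := rfl

@[simp]
theorem pad_apply_of_mem (y : EuclideanSpace ℝ I) {i : Fin d} (h : i ∈ I) :
    pad I y i = y ⟨i, h⟩ := by rw [pad_apply, dif_pos h]

@[simp]
theorem pad_apply_of_notMem (y : EuclideanSpace ℝ I) {i : Fin d} (h : i ∉ I) :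
    pad I y i = 0 := by rw [pad_apply, dif_neg h]

@[simp]
theorem subvec_pad (y : EuclideanSpace ℝ I) : subvec I (pad I y) = y := by
  ext i
  simp

theorem pad_subvec {x : EuclideanSpace ℝ (Fin d)} (h : ∀ i ∉ I, x i = 0) :
    pad I (subvec I x) = x := by
  ext i
  by_cases hi : i ∈ I
  · simp [hi]
  · simp [hi, h i hi]

theorem inner_pad_left (y : EuclideanSpace ℝ I) (x : EuclideanSpace ℝ (Fin d)) :
    inner ℝ (pad I y) x = inner ℝ y (subvec I x) := by
  simp only [PiLp.inner_apply, subvec_apply]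
  rw [← Finset.sum_subset (Finset.subset_univ I), ← Finset.sum_coe_sort I]
  · refine Finset.sum_congr rfl fun i _ => ?_
    simp
  · intro i _ hi
    simp [hi]

theorem inner_pad_right (y : EuclideanSpace ℝ I) (x : EuclideanSpace ℝ (Fin d)) :
    inner ℝ x (pad I y) = inner ℝ (subvec I x) y := by
  rw [real_inner_comm, inner_pad_left, real_inner_comm]

@[simp]
theorem norm_pad (y : EuclideanSpace ℝ I) : ‖pad I y‖ = ‖y‖ := by
  have h : ‖pad I y‖ ^ 2 = ‖y‖ ^ 2 := by
    rw [← real_inner_self_eq_norm_sq, inner_pad_left, subvec_pad, real_inner_self_eq_norm_sq]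
  exact (pow_left_inj₀ (norm_nonneg _) (norm_nonneg _) two_ne_zero).1 h

theorem norm_subvec_le (x : EuclideanSpace ℝ (Fin d)) : ‖subvec I x‖ ≤ ‖x‖ := by
  have h : ‖subvec I x‖ ^ 2 ≤ ‖subvec I x‖ * ‖x‖ := by
    rw [← real_inner_self_eq_norm_sq, ← inner_pad_left]
    refine (real_inner_le_norm _ _).trans ?_
    rw [norm_pad]
  by_contra hc
  push Not at hc
  have := norm_nonneg x
  nlinarith

theorem norm_submat_le (A : EuclideanSpace ℝ (Fin d) →L[ℝ] EuclideanSpace ℝ (Fin d)) :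
    ‖submat I A‖ ≤ ‖A‖ := by
  refine ContinuousLinearMap.opNorm_le_bound _ (norm_nonneg _) fun v => ?_
  refine (norm_subvec_le _).trans ?_
  rw [← norm_pad (I := I) v]
  exact A.le_opNorm _

theorem submat_apply (A : EuclideanSpace ℝ (Fin d) →L[ℝ] EuclideanSpace ℝ (Fin d))
    (v : EuclideanSpace ℝ I) : submat I A v = subvec I (A (pad I v)) := rfl

theorem submat_sub (A B : EuclideanSpace ℝ (Fin d) →L[ℝ] EuclideanSpace ℝ (Fin d)) :
    submat I (A - B) = submat I A - submat I B := by
  ext v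
  simp [submat_apply]

variable {f : EuclideanSpace ℝ (Fin d) → ℝ}

theorem gradient_restrictTo (hf : ContDiff ℝ 2 f) (y : EuclideanSpace ℝ I) :
    gradient (restrictTo f I) y = subvec I (gradient f (pad I y)) := by
  refine ext_inner_right ℝ fun v => ?_
  have h := (((hf.differentiable (by norm_num)) (pad I y)).hasFDerivAt).comp y
    (pad I).hasFDerivAt
  have h2 : restrictTo f I = f ∘ pad I := rfl
  rw [inner_gradient_left, h2, h.fderiv, ← inner_pad_right, inner_gradient_left]
  rfl

theorem hessian_restrictTo (hf : ContDiff ℝ 2 f) (y : EuclideanSpace ℝ I) :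
    hessian (restrictTo f I) y = submat I (hessian f (pad I y)) := by
  have h := (subvec I).hasFDerivAt.comp y
    ((hasFDerivAt_gradient hf (pad I y)).comp y (pad I).hasFDerivAt)
  have h2 : gradient (restrictTo f I) = subvec I ∘ gradient f ∘ pad I :=
    funext fun y => gradient_restrictTo hf y
  rw [hessian, h2, h.fderiv]
  rfl

end Coordinates

end NewtonMR

/-! ### The step near a nondegenerate minimiser -/

namespace NewtonMR

variable {d : ℕ} {f : EuclideanSpace ℝ (Fin d) → ℝ} {xs : EuclideanSpace ℝ (Fin d)}
  {I : Finset (Fin d)}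

theorem mem_active {x : EuclideanSpace ℝ (Fin d)} {δ : ℝ} {i : Fin d} :
    i ∈ active x δ ↔ 0 ≤ x i ∧ x i ≤ δ := by simp [active]

theorem mem_inactive {x : EuclideanSpace ℝ (Fin d)} {δ : ℝ} {i : Fin d} :
    i ∈ inactive x δ ↔ δ < x i := by simp [inactive]

theorem proj_apply (x : EuclideanSpace ℝ (Fin d)) (i : Fin d) : proj x i = max (x i) 0 := rfl

theorem proj_mem_orthant (x : EuclideanSpace ℝ (Fin d)) : proj x ∈ orthant d :=
  fun i => by rw [proj_apply]; exact le_max_right _ _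

theorem convex_orthant : Convex ℝ (orthant d) := by
  intro x hx y hy a b ha hb _ i
  have := hx i
  have := hy i
  simp only [PiLp.add_apply, PiLp.smul_apply, smul_eq_mul]
  positivity

theorem abs_apply_sub_le (x y : EuclideanSpace ℝ (Fin d)) (i : Fin d) : |x i - y i| ≤ ‖x - y‖ := by
  simpa using PiLp.norm_apply_le (x - y) i

theorem norm_le_sum_of_nonneg {u : EuclideanSpace ℝ (Fin d)} (hu : ∀ i, 0 ≤ u i) :
    ‖u‖ ≤ ∑ i, u i := by
  have h1 : ‖u‖ ^ 2 ≤ ‖u‖ * ∑ i, u i := by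
    rw [EuclideanSpace.norm_sq_eq, Finset.mul_sum]
    refine Finset.sum_le_sum fun i _ => ?_
    rw [sq]
    have h2 := PiLp.norm_apply_le u i
    have h3 : ‖u i‖ = u i := Real.norm_of_nonneg (hu i)
    rw [h3] at h2 ⊢
    exact mul_le_mul_of_nonneg_right h2 (hu i)
  have h4 : 0 ≤ ∑ i, u i := Finset.sum_nonneg fun i _ => hu i
  by_contra hc
  push Not at hc
  have := norm_nonneg u
  nlinarith

theorem exists_coercive_of_pos {V : Type*} [NormedAddCommGroup V] [InnerProductSpace ℝ V]
    [FiniteDimensional ℝ V] (A : V →L[ℝ] V) (hA : ∀ v ≠ 0, 0 < inner ℝ v (A v)) :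
    ∃ μ : ℝ, 0 < μ ∧ ∀ v, μ * ‖v‖ ^ 2 ≤ inner ℝ v (A v) := by
  have hc : Continuous fun v => inner ℝ v (A v) := by fun_prop
  rcases (Metric.sphere (0 : V) 1).eq_empty_or_nonempty with he | hne
  · refine ⟨1, one_pos, fun v => ?_⟩
    have hv : v = 0 := by
      by_contra h
      have h1 : ‖v‖⁻¹ • v ∈ Metric.sphere (0 : V) 1 := by
        rw [mem_sphere_zero_iff_norm, norm_smul, norm_inv, norm_norm,
          inv_mul_cancel₀ (norm_ne_zero_iff.2 h)]
      rw [he] at h1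
      exact h1
    simp [hv]
  · obtain ⟨u, hu, hmin⟩ := (isCompact_sphere (0 : V) 1).exists_isMinOn hne hc.continuousOn
    have hu1 : ‖u‖ = 1 := by simpa using hu
    refine ⟨inner ℝ u (A u), hA u (by rintro rfl; simp at hu1), fun v => ?_⟩
    rcases eq_or_ne v 0 with rfl | h
    · simp
    have hn : ‖v‖ ≠ 0 := norm_ne_zero_iff.2 h
    have h1 : ‖v‖⁻¹ • v ∈ Metric.sphere (0 : V) 1 := by
      rw [mem_sphere_zero_iff_norm, norm_smul, norm_inv, norm_norm, inv_mul_cancel₀ hn]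
    have h2 : inner ℝ u (A u) ≤ inner ℝ (‖v‖⁻¹ • v) (A (‖v‖⁻¹ • v)) := hmin h1
    rw [map_smul, inner_smul_left, inner_smul_right] at h2
    have h3 : 0 < ‖v‖ ^ 2 := by positivity
    calc inner ℝ u (A u) * ‖v‖ ^ 2
        ≤ ((starRingEnd ℝ) ‖v‖⁻¹ * (‖v‖⁻¹ * inner ℝ v (A v))) * ‖v‖ ^ 2 := by gcongr
      _ = inner ℝ v (A v) := by simp; field_simp

/-- Quantitative information on `f` near the minimiser `xs` with inactive set `I`. On the ball of
radius `R` the Hessian differs from that at `xs` by at most `ε`, which is small against the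
coercivity constant `μ`, and the multipliers outside `I` are at least `c`; `L` bounds the Hessian.
The smaller radius `r` is such that a MINRES step from its ball stays in the ball of radius `R` and
the multipliers outweigh the second-order terms. -/
structure LocalModel (f : EuclideanSpace ℝ (Fin d) → ℝ) (xs : EuclideanSpace ℝ (Fin d))
    (δ ρ : ℝ) (I : Finset (Fin d)) (μ L c ε R r : ℝ) : Prop where
  contDiff : ContDiff ℝ 2 f
  apply_eq_zero : ∀ i ∉ I, xs i = 0
  lt_apply : ∀ i ∈ I, 2 * δ < xs i
  gradient_eq_zero : subvec I (gradient f xs) = 0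
  rho_pos : 0 < ρ
  rho_lt : ρ < 1 / 2
  mu_pos : 0 < μ
  coercive : ∀ v, 2 * μ * ‖v‖ ^ 2 ≤ inner ℝ v (submat I (hessian f xs) v)
  c_pos : 0 < c
  eps_nonneg : 0 ≤ ε
  eps_le : 5 * ε ≤ 2 * (1 / 2 - ρ) * μ
  norm_add_eps_le : ‖hessian f xs‖ + ε ≤ L
  L_pos : 0 < L
  R_le_delta : R ≤ δ
  R_le_c : R ≤ c
  hessian_le : ∀ x ∈ Metric.ball xs R, ‖hessian f x - hessian f xs‖ ≤ ε
  le_gradient : ∀ x ∈ Metric.ball xs R, ∀ i ∉ I, c ≤ gradient f x i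
  r_pos : 0 < r
  r_le_R : (1 + 2 * L / μ) * r ≤ R
  r_le_c : L * (2 * L / μ + 3) * r ≤ c / 2

namespace LocalModel

variable {δ ρ μ L c ε R r : ℝ} {x : EuclideanSpace ℝ (Fin d)}

theorem eps_le_mu (M : LocalModel f xs δ ρ I μ L c ε R r) : ε ≤ μ := by
  have := M.rho_pos
  have := M.mu_pos
  have := M.eps_le
  nlinarith

theorem r_le (M : LocalModel f xs δ ρ I μ L c ε R r) : r ≤ R := by
  have h := M.r_le_R
  have h1 := M.r_pos
  have : 0 ≤ 2 * L / μ := by have := M.L_pos; have := M.mu_pos; positivity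
  nlinarith

theorem ball_subset (M : LocalModel f xs δ ρ I μ L c ε R r) :
    Metric.ball xs r ⊆ Metric.ball xs R := Metric.ball_subset_ball M.r_le

theorem R_pos (M : LocalModel f xs δ ρ I μ L c ε R r) : 0 < R := M.r_pos.trans_le M.r_le

theorem center_mem (M : LocalModel f xs δ ρ I μ L c ε R r) : xs ∈ Metric.ball xs R :=
  Metric.mem_ball_self M.R_pos

theorem norm_submat_hessian_sub_le (M : LocalModel f xs δ ρ I μ L c ε R r)
    (hx : x ∈ Metric.ball xs R) :
    ‖submat I (hessian f x) - submat I (hessian f xs)‖ ≤ ε := by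
  rw [← submat_sub]
  exact (norm_submat_le _).trans (M.hessian_le x hx)

theorem abs_inner_submat_sub_le (M : LocalModel f xs δ ρ I μ L c ε R r)
    (hx : x ∈ Metric.ball xs R) (v : EuclideanSpace ℝ I) :
    |inner ℝ v (submat I (hessian f x) v) - inner ℝ v (submat I (hessian f xs) v)| ≤
      ε * ‖v‖ ^ 2 := by
  rw [← inner_sub_right, ← sub_apply]
  refine (abs_real_inner_le_norm _ _).trans ?_
  have h := (submat I (hessian f x) - submat I (hessian f xs)).le_of_opNorm_le
    (M.norm_submat_hessian_sub_le hx) v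
  calc _ ≤ ‖v‖ * (ε * ‖v‖) := by gcongr
    _ = _ := by ring

theorem coercive_hessian (M : LocalModel f xs δ ρ I μ L c ε R r) (hx : x ∈ Metric.ball xs R)
    (v : EuclideanSpace ℝ I) : μ * ‖v‖ ^ 2 ≤ inner ℝ v (submat I (hessian f x) v) := by
  have h1 := M.coercive v
  have h2 := (abs_le.1 (M.abs_inner_submat_sub_le hx v)).1
  have h3 : ε * ‖v‖ ^ 2 ≤ μ * ‖v‖ ^ 2 := mul_le_mul_of_nonneg_right M.eps_le_mu (by positivity)
  linarith

theorem norm_submat_hessian_le (M : LocalModel f xs δ ρ I μ L c ε R r)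
    (hx : x ∈ Metric.ball xs R) : ‖submat I (hessian f x)‖ ≤ L := by
  refine (norm_submat_le _).trans (le_trans ?_ M.norm_add_eps_le)
  have := norm_le_norm_add_norm_sub (hessian f xs) (hessian f x)
  rw [norm_sub_rev] at this
  linarith [M.hessian_le x hx]

theorem norm_gradient_sub_sub_le (M : LocalModel f xs δ ρ I μ L c ε R r)
    (hx : x ∈ Metric.ball xs R) :
    ‖gradient f x - gradient f xs - hessian f xs (x - xs)‖ ≤ ε * ‖x - xs‖ :=
  NewtonMR.norm_gradient_sub_sub_le M.contDiff (convex_ball xs R) M.hessian_le M.center_mem hx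

theorem norm_subvec_gradient_le (M : LocalModel f xs δ ρ I μ L c ε R r)
    (hx : x ∈ Metric.ball xs R) : ‖subvec I (gradient f x)‖ ≤ L * ‖x - xs‖ := by
  have h1 : subvec I (gradient f x) = subvec I (gradient f x - gradient f xs) := by
    rw [map_sub, M.gradient_eq_zero, sub_zero]
  rw [h1]
  refine (norm_subvec_le _).trans ?_
  have h2 := norm_le_norm_add_norm_sub (hessian f xs (x - xs)) (gradient f x - gradient f xs)
  rw [norm_sub_rev (hessian f xs (x - xs))] at h2
  have h3 := (hessian f xs).le_opNorm (x - xs)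
  have h4 := M.norm_gradient_sub_sub_le hx
  have h5 := mul_le_mul_of_nonneg_right M.norm_add_eps_le (norm_nonneg (x - xs))
  linarith

theorem inactive_eq (M : LocalModel f xs δ ρ I μ L c ε R r) (hx : x ∈ Metric.ball xs R) :
    inactive x δ = I := by
  have hx' := mem_ball_iff_norm.1 hx
  have hR := M.R_le_delta
  ext i
  have h := abs_le.1 (abs_apply_sub_le x xs i)
  rw [mem_inactive]
  constructor
  · intro hi
    by_contra hI
    rw [M.apply_eq_zero i hI] at h
    linarith
  · intro hi
    have := M.lt_apply i hi
    linarith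

theorem pos_of_mem (M : LocalModel f xs δ ρ I μ L c ε R r) (hx : x ∈ Metric.ball xs R)
    {i : Fin d} (hi : i ∈ I) : δ < x i := by
  rw [← M.inactive_eq hx] at hi
  exact mem_inactive.1 hi

theorem active_eq (M : LocalModel f xs δ ρ I μ L c ε R r) (hx : x ∈ Metric.ball xs R)
    (hx0 : x ∈ orthant d) : active x δ = Iᶜ := by
  ext i
  rw [Finset.mem_compl, ← M.inactive_eq hx, mem_active, mem_inactive, not_lt]
  exact ⟨fun h => h.2, fun h => ⟨hx0 i, h⟩⟩

theorem active_zero_eq (M : LocalModel f xs δ ρ I μ L c ε R r) (hx : x ∈ Metric.ball xs R)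
    (h0 : ∀ i ∉ I, x i = 0) : active x 0 = Iᶜ := by
  ext i
  rw [Finset.mem_compl, mem_active]
  constructor
  · intro h hi
    have := M.pos_of_mem hx hi
    have := M.R_le_delta
    have := M.R_pos
    linarith [h.2]
  · intro h
    rw [h0 i h]
    exact ⟨le_rfl, le_rfl⟩

/-- The multipliers control the part of a feasible point outside `I`. -/
theorem mul_norm_le_inner_gradient (M : LocalModel f xs δ ρ I μ L c ε R r)
    (hx : x ∈ Metric.ball xs R) (hx0 : x ∈ orthant d) :
    c * ‖x - pad I (subvec I x)‖ ≤ inner ℝ (gradient f x) (x - pad I (subvec I x)) := by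
  have hu : ∀ i, 0 ≤ (x - pad I (subvec I x)) i ∧ (i ∈ I → (x - pad I (subvec I x)) i = 0) := by
    intro i
    by_cases hi : i ∈ I
    · simp [hi]
    · simp [hi, hx0 i]
  refine (mul_le_mul_of_nonneg_left (norm_le_sum_of_nonneg fun i => (hu i).1) M.c_pos.le).trans ?_
  rw [PiLp.inner_apply, Finset.mul_sum]
  refine Finset.sum_le_sum fun i _ => ?_
  by_cases hi : i ∈ I
  · rw [(hu i).2 hi]; simp
  · have h := mul_le_mul_of_nonneg_right (M.le_gradient x hx i hi) (hu i).1
    simpa [mul_comm] using h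

theorem norm_sub_pad_subvec_le (M : LocalModel f xs δ ρ I μ L c ε R r) :
    ‖x - pad I (subvec I x)‖ ≤ ‖x - xs‖ := by
  have h1 : x - pad I (subvec I x) = (x - xs) - pad I (subvec I (x - xs)) := by
    rw [map_sub, map_sub, pad_subvec M.apply_eq_zero]; abel
  rw [h1]
  set u := x - xs
  have h2 : ‖u - pad I (subvec I u)‖ ^ 2 ≤ ‖u‖ ^ 2 := by
    rw [norm_sub_sq_real, inner_pad_right, real_inner_self_eq_norm_sq, norm_pad]
    nlinarith [sq_nonneg ‖subvec I u‖]
  exact (pow_le_pow_iff_left₀ (norm_nonneg _) (norm_nonneg _) two_ne_zero).1 h2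

theorem norm_pad_sub_le (M : LocalModel f xs δ ρ I μ L c ε R r) (s : EuclideanSpace ℝ I) :
    ‖pad I (subvec I x + s) - xs‖ ≤ ‖x - xs‖ + ‖s‖ := by
  have h1 : pad I (subvec I x + s) - xs = pad I (subvec I (x - xs) + s) := by
    rw [map_sub, map_add, map_add, map_sub, pad_subvec M.apply_eq_zero]; abel
  rw [h1, norm_pad]
  exact (norm_add_le _ _).trans (by gcongr; exact norm_subvec_le _)

theorem pad_mem_ball (M : LocalModel f xs δ ρ I μ L c ε R r) (hx : x ∈ Metric.ball xs r)
    {s : EuclideanSpace ℝ I} (hs : ‖s‖ ≤ 2 * L / μ * ‖x - xs‖) :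
    pad I (subvec I x + s) ∈ Metric.ball xs R := by
  have hμ := M.mu_pos
  have hL := M.L_pos
  rw [mem_ball_iff_norm] at hx ⊢
  have h1 := M.norm_pad_sub_le (x := x) s
  have h3 : 0 < 1 + 2 * L / μ := by positivity
  have h2 := mul_lt_mul_of_pos_left hx h3
  linarith [M.r_le_R]

/-- Sufficient decrease at the unit step. On `I` the direction `s` satisfies
`⟪g, s⟫ ≤ -⟪s, H s⟫`, which leaves `(1 / 2 - ρ) ⟪s, H s⟫` to absorb the Taylor remainder; outside
`I` the point moves to zero, and the first-order gain due to the multipliers dominates all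
second-order terms that involve this part of the step. -/
theorem sufficient_decrease (M : LocalModel f xs δ ρ I μ L c ε R r) (hx : x ∈ Metric.ball xs r)
    (hx0 : x ∈ orthant d) {s : EuclideanSpace ℝ I}
    (hs : inner ℝ (subvec I (gradient f x)) s ≤ -inner ℝ s (submat I (hessian f x) s))
    (hsn : ‖s‖ ≤ 2 * L / μ * ‖x - xs‖) :
    f (pad I (subvec I x + s)) - f x ≤
      ρ * (inner ℝ (subvec I (gradient f x)) s -
        inner ℝ (gradient f x) (x - pad I (subvec I x))) := by
  have hxR := M.ball_subset hx
  have hxr : ‖x - xs‖ < r := mem_ball_iff_norm.1 hx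
  have hLpos := M.L_pos
  have hμ := M.mu_pos
  set u := x - pad I (subvec I x) with hu
  have hun : ‖u‖ ≤ ‖x - xs‖ := M.norm_sub_pad_subvec_le
  have hz : pad I (subvec I x + s) ∈ Metric.ball xs R := M.pad_mem_ball hx hsn
  have hd : pad I (subvec I x + s) - x = pad I s - u := by
    rw [hu, map_add]; abel
  have hT := (abs_le.1 (abs_taylor_le M.contDiff (convex_ball xs R)
    (hessian_symm M.contDiff xs) M.hessian_le hxR hz)).2
  rw [hd, inner_sub_right (gradient f x), inner_pad_right] at hT
  have hG := M.mul_norm_le_inner_gradient hxR hx0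
  rw [← hu] at hG
  set A := hessian f xs with hA
  have hQ1 : inner ℝ (pad I s - u) (A (pad I s - u)) ≤
      inner ℝ s (submat I A s) + 2 * L * ‖s‖ * ‖u‖ + L * ‖u‖ ^ 2 := by
    have hAL : ‖A‖ ≤ L := by linarith [M.norm_add_eps_le, M.eps_nonneg]
    have hb : ∀ v w, |inner ℝ v (A w)| ≤ L * ‖v‖ * ‖w‖ := by
      intro v w
      refine (abs_real_inner_le_norm _ _).trans ?_
      have h1 := A.le_of_opNorm_le hAL w
      calc _ ≤ ‖v‖ * (L * ‖w‖) := by gcongr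
        _ = _ := by ring
    rw [map_sub, inner_sub_left, inner_sub_right, inner_sub_right, inner_pad_left (I := I) s,
      inner_pad_left (I := I) s, submat_apply]
    have h1 := abs_le.1 (hb (pad I s) u)
    have h2 := abs_le.1 (hb u (pad I s))
    have h3 := abs_le.1 (hb u u)
    rw [inner_pad_left] at h1
    rw [norm_pad] at h1 h2
    nlinarith [h1.1, h2.1, h3.2]
  have hQ2 := (abs_le.1 (M.abs_inner_submat_sub_le hxR s)).1
  have hQ3 := M.coercive_hessian hxR s
  set Q := inner ℝ s (submat I (hessian f x) s)
  have hdn : ‖pad I s - u‖ ^ 2 ≤ 2 * ‖s‖ ^ 2 + 2 * ‖u‖ ^ 2 := by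
    have h1 := norm_sub_le (pad I s) u
    rw [norm_pad] at h1
    have h2 := pow_le_pow_left₀ (norm_nonneg _) h1 2
    nlinarith [sq_nonneg (‖s‖ - ‖u‖)]
  have hdn' := mul_le_mul_of_nonneg_left hdn M.eps_nonneg
  have hεL : ε ≤ L := by linarith [M.norm_add_eps_le, norm_nonneg A]
  have hcu : (L * ‖s‖ + L / 2 * ‖u‖ + 2 * ε * ‖u‖) * ‖u‖ ≤ c / 2 * ‖u‖ := by
    refine mul_le_mul_of_nonneg_right ?_ (norm_nonneg _)
    refine le_trans ?_ M.r_le_c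
    have h1 : L * ‖s‖ ≤ L * (2 * L / μ * r) := by
      gcongr
      exact hsn.trans (by gcongr)
    have h2 : L / 2 * ‖u‖ ≤ L / 2 * r := by gcongr; linarith
    have h3 : 2 * ε * ‖u‖ ≤ 2 * L * r := by
      have := M.eps_nonneg
      gcongr; linarith
    have h4 : 0 < L * r := mul_pos hLpos M.r_pos
    linarith
  have hρ := M.rho_lt
  have hε := mul_le_mul_of_nonneg_right M.eps_le (sq_nonneg ‖s‖)
  have h6 : (1 - ρ) * inner ℝ (subvec I (gradient f x)) s ≤ (1 - ρ) * -Q :=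
    mul_le_mul_of_nonneg_left hs (by linarith)
  have h7 : (1 / 2 - ρ) * (μ * ‖s‖ ^ 2) ≤ (1 / 2 - ρ) * Q :=
    mul_le_mul_of_nonneg_left hQ3 (by linarith)
  have h8 : 1 / 2 * inner ℝ (gradient f x) u ≤ (1 - ρ) * inner ℝ (gradient f x) u := by
    refine mul_le_mul_of_nonneg_right (by linarith) (le_trans ?_ hG)
    have := M.c_pos
    positivity
  nlinarith [hT, hQ1, hQ2, hdn', hcu, h6, h7, h8, hG, hε]

/-- The consequences of an iteration of the method that starts near the minimiser: MINRES returns a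
direction of type SOL, the unit step is accepted, and the new iterate vanishes outside `I`. -/
theorem step (M : LocalModel f xs δ ρ I μ L c ε R r) (hx : x ∈ Metric.ball xs r)
    (hx0 : x ∈ orthant d) {ζ : ℝ} {test : InnerTest d}
    {p x' : EuclideanSpace ℝ (Fin d)} {D : StepType} {α : ℝ}
    (h : IsLocalPhaseStep f ρ ζ δ test x p D α x') :
    MINRESReturns (submat I (hessian f x)) (subvec I (gradient f x))
      (test I (submat I (hessian f x)) (subvec I (gradient f x))) 0 (subvec I p) D ∧
    α = 1 ∧ x' = pad I (subvec I x + subvec I p) ∧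
    ‖subvec I p‖ ≤ 2 * L / μ * ‖x - xs‖ ∧
    f x' - f x ≤ ρ * inner ℝ (subvec I (gradient f x)) (subvec I p) := by
  have hxR := M.ball_subset hx
  have hxr : ‖x - xs‖ < r := mem_ball_iff_norm.1 hx
  have hμ := M.mu_pos
  have hL := M.L_pos
  obtain ⟨hpA, hmr, hbt, hx'⟩ := h
  rw [M.inactive_eq hxR] at hmr
  rw [M.active_eq hxR hx0] at hpA
  obtain ⟨-, -, hdesc, hres, -⟩ := hmr.of_coercive hμ (M.coercive_hessian hxR) hL
    (M.norm_submat_hessian_le hxR)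
  have hsn : ‖subvec I p‖ ≤ 2 * L / μ * ‖x - xs‖ := by
    refine (norm_le_of_norm_residual_le hμ (M.coercive_hessian hxR) hres).trans ?_
    have h1 : 2 / μ * ‖subvec I (gradient f x)‖ ≤ 2 / μ * (L * ‖x - xs‖) := by
      gcongr
      exact M.norm_subvec_gradient_le hxR
    refine h1.trans (le_of_eq ?_)
    ring
  have hdec := M.sufficient_decrease hx hx0 hdesc hsn
  have hz : pad I (subvec I x + subvec I p) ∈ Metric.ball xs R := M.pad_mem_ball hx hsn
  have hproj : proj (x + (1 : ℝ) • p) = pad I (subvec I x + subvec I p) := by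
    ext i
    rw [proj_apply, one_smul, PiLp.add_apply]
    by_cases hi : i ∈ I
    · have h1 := M.pos_of_mem hz hi
      rw [pad_apply_of_mem _ hi] at h1 ⊢
      have h2 := M.R_le_delta
      have h3 := M.R_pos
      exact max_eq_left (by linarith [show (subvec I x + subvec I p) ⟨i, hi⟩ = x i + p i from rfl])
    · rw [pad_apply_of_notMem _ hi]
      refine max_eq_right ?_
      have h1 : p i = -gradient f x i := by
        have := congrArg (fun v => v ⟨i, Finset.mem_compl.2 hi⟩) hpA
        simpa using this
      have h2 := M.le_gradient x hxR i hi
      have h3 := (abs_le.1 (abs_apply_sub_le x xs i)).2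
      rw [M.apply_eq_zero i hi] at h3
      have h4 := mem_ball_iff_norm.1 hxR
      have h5 := M.R_le_c
      rw [h1]
      linarith
  have hcrit : LineSearchCriterion f ρ δ x p 1 := by
    rw [LineSearchCriterion, M.inactive_eq hxR, M.active_eq hxR hx0, hproj]
    have h1 : pad Iᶜ (subvec Iᶜ (pad I (subvec I x + subvec I p)) - subvec Iᶜ x) =
        -(x - pad I (subvec I x)) := by
      ext i
      by_cases hi : i ∈ I
      · simp [hi]
      · simp [hi]
    rw [← inner_pad_right, h1, inner_neg_right]
    linarith
  have hα : α = 1 := by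
    obtain ⟨m, rfl, -, hm⟩ := hbt
    rcases Nat.eq_zero_or_pos m with rfl | hpos
    · simp
    · exact absurd (by simpa using hcrit) (hm 0 hpos)
  refine ⟨hmr, hα, by rw [hx', hα, hproj], hsn, ?_⟩
  rw [hx', hα, hproj]
  have h1 : 0 ≤ ρ * inner ℝ (gradient f x) (x - pad I (subvec I x)) := by
    have h2 := M.mul_norm_le_inner_gradient hxR hx0
    have := M.c_pos
    have := M.rho_pos
    exact mul_nonneg this.le (le_trans (by positivity) h2)
  linarith

end LocalModel

end NewtonMR

/-! ### Existence of the local model -/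

namespace NewtonMR

variable {d : ℕ} {f : EuclideanSpace ℝ (Fin d) → ℝ} {xs : EuclideanSpace ℝ (Fin d)}

theorem coe_lt_of_succ_le {k : ℕ} {K : ℕ∞} (h : ((k + 1 : ℕ) : ℕ∞) ≤ K) : (k : ℕ∞) < K :=
  lt_of_lt_of_le (by exact_mod_cast k.lt_succ_self) h

theorem eq_zero_of_notMem_inactive (hxs : xs ∈ orthant d) {i : Fin d} (hi : i ∉ inactive xs 0) :
    xs i = 0 := by
  rw [mem_inactive, not_lt] at hi
  exact le_antisymm hi (hxs i)

theorem isLocalMin_restrictTo (hxs : xs ∈ orthant d) (hmin : IsLocalMinOn f (orthant d) xs) :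
    IsLocalMin (restrictTo f (inactive xs 0)) (subvec (inactive xs 0) xs) := by
  have hpad : pad (inactive xs 0) (subvec (inactive xs 0) xs) = xs :=
    pad_subvec fun i hi => eq_zero_of_notMem_inactive hxs hi
  have hpos : ∀ᶠ y in 𝓝 (subvec (inactive xs 0) xs), ∀ i : inactive xs 0, 0 < y i := by
    refine eventually_all.2 fun i => ?_
    have hc : Continuous fun y : EuclideanSpace ℝ (inactive xs 0) => y i := by fun_prop
    exact hc.continuousAt.eventually (lt_mem_nhds (mem_inactive.1 i.2))
  have ht : Tendsto (pad (inactive xs 0)) (𝓝 (subvec (inactive xs 0) xs))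
      (𝓝[orthant d] xs) := by
    refine tendsto_nhdsWithin_iff.2 ⟨?_, ?_⟩
    · have := (pad (inactive xs 0)).continuous.tendsto (subvec (inactive xs 0) xs)
      rwa [hpad] at this
    · filter_upwards [hpos] with y hy i
      by_cases hi : i ∈ inactive xs 0
      · rw [pad_apply_of_mem _ hi]
        exact (hy ⟨i, hi⟩).le
      · rw [pad_apply_of_notMem _ hi]
  have h := ht.eventually hmin
  filter_upwards [h] with y hy
  rw [restrictTo, restrictTo, hpad]
  exact hy

theorem exists_localModel (hf : ContDiff ℝ 2 f) (hxs : xs ∈ orthant d)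
    (hmin : IsLocalMinOn f (orthant d) xs) (hnd : Nondegenerate f xs)
    (hso : SecondOrderSufficient f xs) {δ : ℝ} (hδ : 0 < δ)
    (hδxs : ∀ i ∈ inactive xs 0, δ < 1 / 2 * xs i) {ρ : ℝ} (hρ : 0 < ρ) (hρ' : ρ < 1 / 2) :
    ∃ μ L c ε R r : ℝ, LocalModel f xs δ ρ (inactive xs 0) μ L c ε R r := by
  set I := inactive xs 0 with hI
  have hxs0 : ∀ i ∉ I, xs i = 0 := fun i hi => eq_zero_of_notMem_inactive hxs hi
  have hact : ∀ i, i ∉ I ↔ i ∈ active xs 0 := by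
    intro i
    rw [mem_active, hI, mem_inactive, not_lt]
    exact ⟨fun h => ⟨hxs i, h⟩, fun h => h.2⟩
  have hgrad : subvec I (gradient f xs) = 0 := by
    have h1 := (isLocalMin_restrictTo hxs hmin).fderiv_eq_zero
    have h2 := gradient_restrictTo (I := I) hf (subvec I xs)
    rw [pad_subvec hxs0] at h2
    rw [← h2, gradient, h1, map_zero]
  obtain ⟨μ₀, hμ₀, hco⟩ := exists_coercive_of_pos (submat I (hessian f xs)) (by
    intro v hv
    rw [submat_apply, ← inner_pad_left]
    refine hso _ (fun h => hv ?_) fun i hi => pad_apply_of_notMem _ ((hact i).2 hi)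
    rw [← norm_eq_zero, norm_pad, norm_eq_zero] at h
    exact h)
  obtain ⟨c, hc0, hc⟩ : ∃ c : ℝ, 0 < c ∧ ∀ i, i ∉ I → c < gradient f xs i := by
    have h : ∀ᶠ c : ℝ in 𝓝[>] 0, ∀ i, i ∉ I → c < gradient f xs i := by
      refine eventually_all.2 fun i => ?_
      by_cases hi : i ∈ I
      · exact Eventually.of_forall fun _ h => absurd hi h
      · have := hnd i ((hact i).1 hi)
        filter_upwards [nhdsWithin_le_nhds (gt_mem_nhds this)] with c hc _ using hc
    exact ((eventually_mem_nhdsWithin (a := (0 : ℝ)) (s := Set.Ioi 0)).and h).exists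
  set ε := 2 / 5 * (1 / 2 - ρ) * (μ₀ / 2) with hε
  have hε0 : 0 < ε := by
    have : 0 < 1 / 2 - ρ := by linarith
    positivity
  set L := ‖hessian f xs‖ + ε with hL
  have hL0 : 0 < L := by positivity
  obtain ⟨R₀, hR₀, hball⟩ := Metric.eventually_nhds_iff_ball.1
    (((((continuous_hessian hf).sub continuous_const).norm.continuousAt (x := xs)).eventually
      (gt_mem_nhds (show ‖hessian f xs - hessian f xs‖ < ε by simpa using hε0))).and
      (eventually_all.2 fun i =>
        (show ∀ᶠ x in 𝓝 xs, i ∉ I → c < gradient f x i by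
          by_cases hi : i ∈ I
          · exact Eventually.of_forall fun _ h => absurd hi h
          · have h1 : Continuous (gradient f) := (contDiff_gradient hf).continuous
            have h2 : Continuous fun x => gradient f x i := by fun_prop
            filter_upwards [h2.continuousAt.eventually (lt_mem_nhds (hc i hi))] with x hx _
              using hx)))
  set R := min R₀ (min δ c) with hR
  have hR0 : 0 < R := by positivity
  have hC : 0 < 1 + 2 * L / (μ₀ / 2) := by positivity
  have hC' : 0 < L * (2 * L / (μ₀ / 2) + 3) := by positivity
  refine ⟨μ₀ / 2, L, c, ε, R,
    min (R / (1 + 2 * L / (μ₀ / 2))) (c / 2 / (L * (2 * L / (μ₀ / 2) + 3))), ?_⟩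
  exact
    { contDiff := hf
      apply_eq_zero := hxs0
      lt_apply := fun i hi => by have := hδxs i hi; linarith
      gradient_eq_zero := hgrad
      rho_pos := hρ
      rho_lt := hρ'
      mu_pos := by positivity
      coercive := fun v => by have := hco v; linarith
      c_pos := hc0
      eps_nonneg := hε0.le
      eps_le := by rw [hε]; linarith
      norm_add_eps_le := le_rfl
      L_pos := hL0
      R_le_delta := (min_le_right _ _).trans (min_le_left _ _)
      R_le_c := (min_le_right _ _).trans (min_le_right _ _)
      hessian_le := fun x hx =>
        (hball x (Metric.ball_subset_ball (min_le_left _ _) hx)).1.le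
      le_gradient := fun x hx i hi =>
        ((hball x (Metric.ball_subset_ball (min_le_left _ _) hx)).2 i hi).le
      r_pos := by positivity
      r_le_R := by
        rw [mul_comm, ← le_div_iff₀ hC]
        exact min_le_left _ _
      r_le_c := by
        rw [mul_comm, ← le_div_iff₀ hC']
        exact min_le_right _ _ }

/-! ### Stability of the iteration -/

namespace LocalModel

variable {I : Finset (Fin d)} {δ ρ μ L c ε R r : ℝ} {x : EuclideanSpace ℝ (Fin d)}

theorem norm_subvec_sub (M : LocalModel f xs δ ρ I μ L c ε R r) (h0 : ∀ i ∉ I, x i = 0) :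
    ‖subvec I (x - xs)‖ = ‖x - xs‖ := by
  rw [← norm_pad (subvec I (x - xs)), pad_subvec]
  intro i hi
  simp [h0 i hi, M.apply_eq_zero i hi]

/-- Quadratic growth of `f` on the face of the orthant that contains `xs`. -/
theorem quadratic_growth (M : LocalModel f xs δ ρ I μ L c ε R r) (hx : x ∈ Metric.ball xs R)
    (h0 : ∀ i ∉ I, x i = 0) : f xs + μ / 2 * ‖x - xs‖ ^ 2 ≤ f x := by
  have h1 := (abs_le.1 (abs_taylor_le M.contDiff (convex_ball xs R)
    (hessian_symm M.contDiff xs) M.hessian_le M.center_mem hx)).1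
  have h2 : pad I (subvec I (x - xs)) = x - xs := pad_subvec fun i hi => by
    simp [h0 i hi, M.apply_eq_zero i hi]
  have h3 : inner ℝ (gradient f xs) (x - xs) = 0 := by
    rw [← h2, inner_pad_right, M.gradient_eq_zero, inner_zero_left]
  have h4 : inner ℝ (x - xs) (hessian f xs (x - xs)) =
      inner ℝ (subvec I (x - xs)) (submat I (hessian f xs) (subvec I (x - xs))) := by
    rw [submat_apply, ← inner_pad_left, h2]
  have h5 := M.coercive (subvec I (x - xs))
  rw [M.norm_subvec_sub h0] at h5
  rw [h3, h4] at h1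
  have h6 : 2 * ε ≤ μ := by
    have := M.eps_le
    have := M.rho_pos
    have := M.mu_pos
    nlinarith
  have h7 := mul_le_mul_of_nonneg_right h6 (sq_nonneg ‖x - xs‖)
  linarith

/-- The region in which the iterates remain: points of a ball around `xs` whose function value is
smaller than that of the points of the face of the orthant on the bounding sphere. -/
structure Trapped (_ : LocalModel f xs δ ρ I μ L c ε R r) (x : EuclideanSpace ℝ (Fin d)) :
    Prop where
  mem_orthant : x ∈ orthant d
  mem_ball : x ∈ Metric.ball xs r
  lt : f x < f xs + μ / 2 * r ^ 2

theorem exists_ball_trapped (M : LocalModel f xs δ ρ I μ L c ε R r) :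
    ∃ Δ : ℝ, 0 < Δ ∧ ∀ x ∈ orthant d, x ∈ Metric.ball xs Δ → M.Trapped x := by
  have h1 : f xs < f xs + μ / 2 * r ^ 2 := by
    have := M.mu_pos
    have := M.r_pos
    have : 0 < μ / 2 * r ^ 2 := by positivity
    linarith
  obtain ⟨Δ, hΔ, h⟩ := Metric.eventually_nhds_iff_ball.1
    ((M.contDiff.continuous.continuousAt.eventually (gt_mem_nhds h1)).and
      (Metric.ball_mem_nhds xs M.r_pos))
  exact ⟨Δ, hΔ, fun x hx0 hx => ⟨hx0, (h x hx).2, (h x hx).1⟩⟩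

theorem Trapped.step {M : LocalModel f xs δ ρ I μ L c ε R r} (hx : M.Trapped x) {ζ : ℝ}
    {test : InnerTest d} {p x' : EuclideanSpace ℝ (Fin d)} {D : StepType} {α : ℝ}
    (h : IsLocalPhaseStep f ρ ζ δ test x p D α x') :
    M.Trapped x' ∧ ∀ i ∉ I, x' i = 0 := by
  obtain ⟨hmr, -, hx', hsn, hdec⟩ := M.step hx.mem_ball hx.mem_orthant h
  have hxR := M.ball_subset hx.mem_ball
  have hμ := M.mu_pos
  have hL := M.L_pos
  obtain ⟨-, -, hdesc, -, -⟩ := hmr.of_coercive hμ (M.coercive_hessian hxR) hL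
    (M.norm_submat_hessian_le hxR)
  have h0 : ∀ i ∉ I, x' i = 0 := fun i hi => by rw [hx', pad_apply_of_notMem _ hi]
  have hz : x' ∈ Metric.ball xs R := hx' ▸ M.pad_mem_ball hx.mem_ball hsn
  have hfle : f x' ≤ f x := by
    have h1 := M.coercive_hessian hxR (subvec I p)
    have h2 : 0 ≤ μ * ‖subvec I p‖ ^ 2 := by positivity
    have h3 := mul_nonneg M.rho_pos.le (show
      0 ≤ -inner ℝ (subvec I (gradient f x)) (subvec I p) by linarith)
    linarith
  have hlt := hfle.trans_lt hx.lt
  refine ⟨⟨by rw [h.2.2.2]; exact proj_mem_orthant _, ?_, hlt⟩, h0⟩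
  rw [mem_ball_iff_norm]
  have h1 := (M.quadratic_growth hz h0).trans_lt hlt
  have h2 : ‖x' - xs‖ ^ 2 < r ^ 2 := by
    have : 0 < μ / 2 := by positivity
    exact lt_of_mul_lt_mul_left (by linarith) this.le
  exact lt_of_pow_lt_pow_left₀ 2 M.r_pos.le h2

/-- From a point of the face of the orthant that contains `xs`, a step of the method is a step of
unconstrained Newton-MR for the restriction of `f` to this face. -/
theorem Trapped.isNewtonMRStep {M : LocalModel f xs δ ρ I μ L c ε R r} (hx : M.Trapped x)
    (h0 : ∀ i ∉ I, x i = 0) {ζ : ℝ} {test : InnerTest d} {p x' : EuclideanSpace ℝ (Fin d)}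
    {D : StepType} {α : ℝ} (h : IsLocalPhaseStep f ρ ζ δ test x p D α x') :
    IsNewtonMRStep (restrictTo f I) ρ ζ (test I) (subvec I x) (subvec I p) D α (subvec I x') := by
  obtain ⟨hmr, hα, hx', -, hdec⟩ := M.step hx.mem_ball hx.mem_orthant h
  have hp : pad I (subvec I x) = x := pad_subvec h0
  refine ⟨?_, ⟨0, by simp [hα], ?_, by simp⟩, by simp [hx', hα]⟩
  · rw [hessian_restrictTo M.contDiff, gradient_restrictTo M.contDiff, hp]
    exact hmr
  · simp only [pow_zero, one_smul, one_mul]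
    rw [restrictTo, restrictTo, gradient_restrictTo M.contDiff, hp, ← hx']
    exact hdec

end LocalModel

end NewtonMR

/-! ### Convergence and rates -/

namespace NewtonMR

variable {d : ℕ} {f : EuclideanSpace ℝ (Fin d) → ℝ} {xs : EuclideanSpace ℝ (Fin d)}
  {I : Finset (Fin d)} {δ ρ μ L c ε R r : ℝ}

namespace LocalModel

theorem mul_norm_le_norm_submat (M : LocalModel f xs δ ρ I μ L c ε R r)
    {x : EuclideanSpace ℝ (Fin d)} (h0 : ∀ i ∉ I, x i = 0) :
    2 * μ * ‖x - xs‖ ≤ ‖submat I (hessian f xs) (subvec I (x - xs))‖ := by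
  rw [← M.norm_subvec_sub h0]
  exact norm_le_of_coercive M.coercive _

theorem norm_submat_subvec_le (M : LocalModel f xs δ ρ I μ L c ε R r)
    (x : EuclideanSpace ℝ (Fin d)) :
    ‖submat I (hessian f xs) (subvec I (x - xs))‖ ≤ L * ‖x - xs‖ := by
  refine ((submat I (hessian f xs)).le_of_opNorm_le (M.norm_submat_hessian_le M.center_mem)
    _).trans ?_
  have := M.L_pos
  gcongr
  exact norm_subvec_le _

theorem norm_submat_sub_gradient_le (M : LocalModel f xs δ ρ I μ L c ε R r)
    {x : EuclideanSpace ℝ (Fin d)} (h0 : ∀ i ∉ I, x i = 0) {ω : ℝ}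
    (hg : ‖gradient f x - gradient f xs - hessian f xs (x - xs)‖ ≤ ω) :
    ‖submat I (hessian f xs) (subvec I (x - xs)) - subvec I (gradient f x)‖ ≤ ω := by
  have h1 : submat I (hessian f xs) (subvec I (x - xs)) - subvec I (gradient f x) =
      -subvec I (gradient f x - gradient f xs - hessian f xs (x - xs)) := by
    rw [submat_apply, pad_subvec, map_sub (subvec I) (gradient f x - gradient f xs),
      map_sub (subvec I) (gradient f x), M.gradient_eq_zero]
    · abel
    · intro i hi
      simp [h0 i hi, M.apply_eq_zero i hi]
  rw [h1, norm_neg]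
  exact (norm_subvec_le _).trans hg

theorem mul_norm_le_norm_gradient (M : LocalModel f xs δ ρ I μ L c ε R r)
    {x : EuclideanSpace ℝ (Fin d)} (hx : x ∈ Metric.ball xs R) (h0 : ∀ i ∉ I, x i = 0) :
    μ * ‖x - xs‖ ≤ ‖subvec I (gradient f x)‖ := by
  have h1 := M.norm_submat_sub_gradient_le h0 (M.norm_gradient_sub_sub_le hx)
  have h2 := M.mul_norm_le_norm_submat h0
  have h3 := norm_le_norm_add_norm_sub (subvec I (gradient f x))
    (submat I (hessian f xs) (subvec I (x - xs)))
  rw [norm_sub_rev (subvec I (gradient f x))] at h3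
  have h4 := mul_le_mul_of_nonneg_right M.eps_le_mu (norm_nonneg (x - xs))
  linarith

/-- The error after a unit step, measured by the Hessian at the minimiser, equals the MINRES
residual up to the linearisation errors of the gradient and the Hessian. -/
theorem norm_submat_next_le (M : LocalModel f xs δ ρ I μ L c ε R r)
    {x : EuclideanSpace ℝ (Fin d)} (h0 : ∀ i ∉ I, x i = 0) {s : EuclideanSpace ℝ I}
    (hs : ‖s‖ ≤ 2 * L / μ * ‖x - xs‖) {θ ω : ℝ} (hθ : 0 ≤ θ)
    (hr : ‖residual (submat I (hessian f x)) (subvec I (gradient f x)) s‖ ≤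
      θ * ‖subvec I (gradient f x)‖)
    (hg : ‖gradient f x - gradient f xs - hessian f xs (x - xs)‖ ≤ ω * ‖x - xs‖)
    (hH : ‖hessian f x - hessian f xs‖ ≤ ω) :
    ‖submat I (hessian f xs) (subvec I (pad I (subvec I x + s) - xs))‖ ≤
      θ * ‖submat I (hessian f xs) (subvec I (x - xs))‖ +
        (θ + 1 + 2 * L / μ) * ω * ‖x - xs‖ := by
  have hω : 0 ≤ ω := (norm_nonneg _).trans hH
  have h1 := M.norm_submat_sub_gradient_le h0 hg
  set A := submat I (hessian f xs)
  set B := submat I (hessian f x)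
  set g := subvec I (gradient f x)
  have h2 : A (subvec I (pad I (subvec I x + s) - xs)) =
      -residual B g s + (A (subvec I (x - xs)) - g) - (B - A) s := by
    rw [map_sub (subvec I), subvec_pad, map_sub (subvec I), residual, sub_apply]
    simp only [map_add, map_sub]
    abel
  have h3 : ‖(B - A) s‖ ≤ ω * (2 * L / μ * ‖x - xs‖) := by
    refine ((B - A).le_of_opNorm_le ?_ s).trans (by gcongr)
    rw [← submat_sub]
    exact (norm_submat_le _).trans hH
  have h4 : ‖g‖ ≤ ‖A (subvec I (x - xs))‖ + ω * ‖x - xs‖ := by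
    have := norm_le_norm_add_norm_sub (A (subvec I (x - xs))) g
    linarith
  have h5 := mul_le_mul_of_nonneg_left h4 hθ
  rw [h2]
  refine (norm_sub_le _ _).trans ?_
  have h6 := norm_add_le (-residual B g s) (A (subvec I (x - xs)) - g)
  rw [norm_neg] at h6
  nlinarith

end LocalModel

/-- A tail of the method inside the trapping region: from the index `N` on, all iterates lie on the
face of the orthant that contains the minimiser, and the unit step along the direction `s k` is
accepted with sufficient decrease. -/
structure IsTail (f : EuclideanSpace ℝ (Fin d) → ℝ) (xs : EuclideanSpace ℝ (Fin d))
    (ρ : ℝ) (I : Finset (Fin d)) (μ L r : ℝ) (x : ℕ → EuclideanSpace ℝ (Fin d))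
    (s : ℕ → EuclideanSpace ℝ I) (N : ℕ) : Prop where
  mem_orthant : ∀ k ≥ N, x k ∈ orthant d
  mem_ball : ∀ k ≥ N, x k ∈ Metric.ball xs r
  eq_zero : ∀ k ≥ N, ∀ i ∉ I, x k i = 0
  next_eq : ∀ k ≥ N, x (k + 1) = pad I (subvec I (x k) + s k)
  norm_le : ∀ k ≥ N, ‖s k‖ ≤ 2 * L / μ * ‖x k - xs‖
  decrease : ∀ k ≥ N, ρ * μ * ‖s k‖ ^ 2 ≤ f (x k) - f (x (k + 1))

namespace IsTail

variable {x : ℕ → EuclideanSpace ℝ (Fin d)} {s : ℕ → EuclideanSpace ℝ I} {N : ℕ}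

/-- The inexact Newton condition at iteration `k` with forcing term `θ`. -/
def Forcing (f : EuclideanSpace ℝ (Fin d) → ℝ) (I : Finset (Fin d))
    (x : ℕ → EuclideanSpace ℝ (Fin d)) (s : ℕ → EuclideanSpace ℝ I) (k : ℕ) (θ : ℝ) : Prop :=
  ‖residual (submat I (hessian f (x k))) (subvec I (gradient f (x k))) (s k)‖ ≤
    θ * ‖subvec I (gradient f (x k))‖

theorem Forcing.mono {k : ℕ} {θ θ' : ℝ} (h : Forcing f I x s k θ) (hθ : θ ≤ θ') :
    Forcing f I x s k θ' := le_trans h (mul_le_mul_of_nonneg_right hθ (norm_nonneg _))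

theorem mul_norm_sub_le (M : LocalModel f xs δ ρ I μ L c ε R r) (T : IsTail f xs ρ I μ L r x s N)
    {θ : ℝ} {k : ℕ} (hk : N ≤ k) (hF : Forcing f I x s k θ) :
    (1 - θ) * μ * ‖x k - xs‖ ≤ L * ‖s k‖ := by
  have hxR := M.ball_subset (T.mem_ball k hk)
  rcases le_or_gt 1 θ with h | h
  · have h1 := M.L_pos
    have h2 : (1 - θ) * μ * ‖x k - xs‖ ≤ 0 := mul_nonpos_of_nonpos_of_nonneg
      (mul_nonpos_of_nonpos_of_nonneg (by linarith) M.mu_pos.le) (norm_nonneg _)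
    exact h2.trans (by positivity)
  · have h1 := mul_le_mul_of_nonneg_left (M.mul_norm_le_norm_gradient hxR (T.eq_zero k hk))
      (show 0 ≤ 1 - θ by linarith)
    rw [mul_assoc]
    refine h1.trans ?_
    have h2 := (submat I (hessian f (x k))).le_of_opNorm_le (M.norm_submat_hessian_le hxR) (s k)
    refine le_trans ?_ h2
    have h3 : -subvec I (gradient f (x k)) =
        residual (submat I (hessian f (x k))) (subvec I (gradient f (x k))) (s k) +
          submat I (hessian f (x k)) (s k) := by
      simp only [residual]; abel
    have h4 := norm_add_le
      (residual (submat I (hessian f (x k))) (subvec I (gradient f (x k))) (s k))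
      (submat I (hessian f (x k)) (s k))
    rw [← h3, norm_neg] at h4
    unfold Forcing at hF
    linarith

/-- The function values decrease and are bounded below, hence the directions tend to zero; forcing
terms bounded away from one make the distance to the minimiser comparable to the length of the
direction. -/
theorem tendsto (M : LocalModel f xs δ ρ I μ L c ε R r) (T : IsTail f xs ρ I μ L r x s N)
    {θ : ℝ} (hθ : θ < 1) (hF : ∀ᶠ k in atTop, Forcing f I x s k θ) :
    Tendsto x atTop (𝓝 xs) := by
  have hρμ : 0 < ρ * μ := mul_pos M.rho_pos M.mu_pos
  have hanti : Antitone fun n => f (x (n + N)) := antitone_nat_of_succ_le fun n => by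
    have h1 := T.decrease (n + N) (by omega)
    have h2 : 0 ≤ ρ * μ * ‖s (n + N)‖ ^ 2 := by positivity
    rw [show n + 1 + N = n + N + 1 by omega]
    linarith
  have hbdd : BddBelow (Set.range fun n => f (x (n + N))) := by
    refine ⟨f xs, ?_⟩
    rintro _ ⟨n, rfl⟩
    have h1 := M.quadratic_growth (M.ball_subset (T.mem_ball (n + N) (by omega)))
      (T.eq_zero (n + N) (by omega))
    have h2 : 0 ≤ μ / 2 * ‖x (n + N) - xs‖ ^ 2 := by have := M.mu_pos; positivity
    change f xs ≤ f (x (n + N))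
    linarith
  have hlim := (tendsto_add_atTop_iff_nat (f := fun k => f (x k)) N).1
    (tendsto_atTop_ciInf hanti hbdd)
  have hdiff : Tendsto (fun k => f (x k) - f (x (k + 1))) atTop (𝓝 0) := by
    have := hlim.sub ((tendsto_add_atTop_iff_nat (f := fun k => f (x k)) 1).2 hlim)
    rwa [sub_self] at this
  rw [tendsto_iff_norm_sub_tendsto_zero]
  set κ := L / ((1 - θ) * μ)
  have hpos : 0 < (1 - θ) * μ := mul_pos (by linarith) M.mu_pos
  have hsq : Tendsto (fun k => ‖x k - xs‖ ^ 2) atTop (𝓝 0) := by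
    have h0 : Tendsto (fun k => κ ^ 2 / (ρ * μ) * (f (x k) - f (x (k + 1)))) atTop (𝓝 0) := by
      simpa using hdiff.const_mul (κ ^ 2 / (ρ * μ))
    refine tendsto_of_tendsto_of_tendsto_of_le_of_le' tendsto_const_nhds h0
      (Eventually.of_forall fun k => by positivity) ?_
    filter_upwards [hF, eventually_ge_atTop N] with k hk hkN
    have h1 := T.mul_norm_sub_le M hkN hk
    have h2 : ‖x k - xs‖ ≤ κ * ‖s k‖ := by
      rw [div_mul_eq_mul_div, le_div_iff₀ hpos]
      linarith
    have h3 := T.decrease k hkN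
    calc ‖x k - xs‖ ^ 2 ≤ (κ * ‖s k‖) ^ 2 := by gcongr
      _ = κ ^ 2 / (ρ * μ) * (ρ * μ * ‖s k‖ ^ 2) := by
        rw [← mul_assoc, div_mul_cancel₀ _ hρμ.ne', mul_pow]
      _ ≤ _ := by gcongr
  have h := hsq.sqrt
  simpa [Real.sqrt_sq (norm_nonneg _)] using h

/-- Near the minimiser the linearisation errors of gradient and Hessian are relatively small. -/
theorem eventually_linearisation (M : LocalModel f xs δ ρ I μ L c ε R r)
    (hx : Tendsto x atTop (𝓝 xs)) {ω : ℝ} (hω : 0 < ω) :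
    ∀ᶠ k in atTop, ‖gradient f (x k) - gradient f xs - hessian f xs (x k - xs)‖ ≤
        ω * ‖x k - xs‖ ∧ ‖hessian f (x k) - hessian f xs‖ ≤ ω := by
  have hc := ((continuous_hessian M.contDiff).sub
    (continuous_const (y := hessian f xs))).norm.continuousAt (x := xs)
  obtain ⟨η, hη, hball⟩ := Metric.eventually_nhds_iff_ball.1 (hc.eventually
    (gt_mem_nhds (show ‖hessian f xs - hessian f xs‖ < ω by simpa using hω)))
  filter_upwards [hx.eventually (Metric.ball_mem_nhds xs hη)] with k hk
  exact ⟨norm_gradient_sub_sub_le M.contDiff (convex_ball xs η) (fun z hz => (hball z hz).le)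
    (Metric.mem_ball_self hη) hk, (hball _ hk).le⟩

theorem norm_submat_next_le (M : LocalModel f xs δ ρ I μ L c ε R r)
    (T : IsTail f xs ρ I μ L r x s N) {k : ℕ} (hk : N ≤ k) {θ ω : ℝ} (hθ : 0 ≤ θ)
    (hF : Forcing f I x s k θ)
    (hg : ‖gradient f (x k) - gradient f xs - hessian f xs (x k - xs)‖ ≤ ω * ‖x k - xs‖)
    (hH : ‖hessian f (x k) - hessian f xs‖ ≤ ω) :
    ‖submat I (hessian f xs) (subvec I (x (k + 1) - xs))‖ ≤
      θ * ‖submat I (hessian f xs) (subvec I (x k - xs))‖ +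
        (θ + 1 + 2 * L / μ) * ω * ‖x k - xs‖ := by
  rw [T.next_eq k hk]
  exact M.norm_submat_next_le (T.eq_zero k hk) (T.norm_le k hk) hθ hF hg hH

theorem linear_rate (M : LocalModel f xs δ ρ I μ L c ε R r) (T : IsTail f xs ρ I μ L r x s N)
    (hx : Tendsto x atTop (𝓝 xs)) {θ q : ℝ} (hθ : 0 ≤ θ) (hq : θ < q)
    (hF : ∀ᶠ k in atTop, Forcing f I x s k θ) :
    ∀ᶠ k in atTop, ‖submat I (hessian f xs) (subvec I (x (k + 1) - xs))‖ ≤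
      q * ‖submat I (hessian f xs) (subvec I (x k - xs))‖ := by
  have hμ := M.mu_pos
  have hL := M.L_pos
  have hK : 0 < θ + 1 + 2 * L / μ := by positivity
  have hω : 0 < (q - θ) * (2 * μ) / (θ + 1 + 2 * L / μ) :=
    div_pos (mul_pos (by linarith) (by positivity)) hK
  filter_upwards [hF, eventually_ge_atTop N, eventually_linearisation M hx hω] with k h1 hk h2
  refine (T.norm_submat_next_le M hk hθ h1 h2.1 h2.2).trans ?_
  rw [mul_div_cancel₀ _ hK.ne', mul_assoc]
  have h3 := mul_le_mul_of_nonneg_left (M.mul_norm_le_norm_submat (T.eq_zero k hk))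
    (show 0 ≤ q - θ by linarith)
  linarith

theorem superlinear_rate (M : LocalModel f xs δ ρ I μ L c ε R r)
    (T : IsTail f xs ρ I μ L r x s N) (hx : Tendsto x atTop (𝓝 xs)) {θ : ℕ → ℝ}
    (hθ : ∀ k, 0 ≤ θ k) (hlim : Tendsto θ atTop (𝓝 0))
    (hF : ∀ᶠ k in atTop, Forcing f I x s k (θ k)) :
    (fun k => x (k + 1) - xs) =o[atTop] fun k => x k - xs := by
  have hμ := M.mu_pos
  have hL := M.L_pos
  refine isLittleO_iff.2 fun τ hτ => ?_
  -- for `θ k ≤ 1` both error terms are made smaller than `μ τ`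
  have hK : 0 < 2 + 2 * L / μ := by positivity
  have hω : 0 < μ * τ / (2 + 2 * L / μ) := by positivity
  have hθ' : 0 < min 1 (μ * τ / L) := by positivity
  filter_upwards [hF, eventually_ge_atTop N, eventually_linearisation M hx hω,
    hlim.eventually (gt_mem_nhds hθ')] with k h1 hk h2 h3
  have h4 := T.norm_submat_next_le M hk (hθ k) h1 h2.1 h2.2
  have h5 := M.mul_norm_le_norm_submat (T.eq_zero (k + 1) (by omega))
  have h6 : θ k * ‖submat I (hessian f xs) (subvec I (x k - xs))‖ ≤ μ * τ * ‖x k - xs‖ := by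
    calc _ ≤ μ * τ / L * (L * ‖x k - xs‖) := by
          have := h3.le.trans (min_le_right _ _)
          have := M.norm_submat_subvec_le (x k)
          gcongr
      _ = _ := by field_simp
  have h7 : (θ k + 1 + 2 * L / μ) * (μ * τ / (2 + 2 * L / μ)) * ‖x k - xs‖ ≤
      μ * τ * ‖x k - xs‖ := by
    have h8 : θ k + 1 + 2 * L / μ ≤ 2 + 2 * L / μ := by
      have := h3.le.trans (min_le_left _ _)
      linarith
    calc _ ≤ (2 + 2 * L / μ) * (μ * τ / (2 + 2 * L / μ)) * ‖x k - xs‖ := by gcongr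
      _ = _ := by rw [mul_div_cancel₀ _ hK.ne']
  have h9 : 2 * μ * ‖x (k + 1) - xs‖ ≤ 2 * μ * (τ * ‖x k - xs‖) := by linarith
  exact le_of_mul_le_mul_left h9 (by positivity)

theorem quadratic_rate (M : LocalModel f xs δ ρ I μ L c ε R r)
    (T : IsTail f xs ρ I μ L r x s N) (hx : Tendsto x atTop (𝓝 xs)) {θ : ℕ → ℝ}
    (hθ : ∀ k, 0 ≤ θ k) (hbig : θ =O[atTop] fun k => ‖subvec I (gradient f (x k))‖)
    (hF : ∀ᶠ k in atTop, Forcing f I x s k (θ k)) (hxs : xs ∈ orthant d) {LH η : ℝ} (hη : 0 < η)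
    (hLip : ∀ y ∈ orthant d ∩ Metric.ball xs η, ∀ z ∈ orthant d ∩ Metric.ball xs η,
      ‖hessian f y - hessian f z‖ ≤ LH * ‖y - z‖) :
    (fun k => x (k + 1) - xs) =O[atTop] fun k => ‖x k - xs‖ ^ 2 := by
  have hμ := M.mu_pos
  have hL := M.L_pos
  obtain ⟨C, hC, hCb⟩ := hbig.exists_pos
  rw [isBigOWith_iff] at hCb
  set Λ := |LH|
  refine IsBigO.of_bound ((C * L * L + (C * L * r + 1 + 2 * L / μ) * Λ) / (2 * μ)) ?_
  filter_upwards [hF, eventually_ge_atTop N, hCb, hx.eventually (Metric.ball_mem_nhds xs hη)]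
    with k h1 hk h2 h3
  set e := ‖x k - xs‖ with he
  have her : e ≤ r := (mem_ball_iff_norm.1 (T.mem_ball k hk)).le
  have he0 : 0 ≤ e := norm_nonneg _
  have hθk : θ k ≤ C * L * e := by
    rw [Real.norm_of_nonneg (hθ k), norm_norm] at h2
    have := M.norm_subvec_gradient_le (M.ball_subset (T.mem_ball k hk))
    calc θ k ≤ C * (L * e) := h2.trans (by gcongr)
      _ = _ := by ring
  -- the Hessian is compared with its value at `xs` on the convex set of feasible points whose
  -- distance to `xs` is at most `e`
  have hs : Convex ℝ (orthant d ∩ Metric.closedBall xs e) :=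
    convex_orthant.inter (convex_closedBall xs e)
  have hsb : ∀ z ∈ orthant d ∩ Metric.closedBall xs e,
      ‖hessian f z - hessian f xs‖ ≤ Λ * e := by
    intro z hz
    have hze : ‖z - xs‖ ≤ e := mem_closedBall_iff_norm.1 hz.2
    refine (hLip z ⟨hz.1, ?_⟩ xs ⟨hxs, Metric.mem_ball_self hη⟩).trans ?_
    · rw [dist_eq_norm] at h3
      rw [mem_ball_iff_norm]
      exact hze.trans_lt h3
    · calc LH * ‖z - xs‖ ≤ Λ * ‖z - xs‖ := by gcongr; exact le_abs_self LH
        _ ≤ Λ * e := by gcongr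
  have hxk : x k ∈ orthant d ∩ Metric.closedBall xs e :=
    ⟨T.mem_orthant k hk, mem_closedBall_iff_norm.2 le_rfl⟩
  have h4 := T.norm_submat_next_le M hk (hθ k) h1
    (norm_gradient_sub_sub_le M.contDiff hs hsb ⟨hxs, Metric.mem_closedBall_self he0⟩ hxk)
    (hsb _ hxk)
  have h5 := M.mul_norm_le_norm_submat (T.eq_zero (k + 1) (by omega))
  rw [← he] at h4
  have h6 : θ k * ‖submat I (hessian f xs) (subvec I (x k - xs))‖ ≤ C * L * e * (L * e) := by
    have := M.norm_submat_subvec_le (x k)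
    gcongr
  have h7 : (θ k + 1 + 2 * L / μ) * (Λ * e) * e ≤ (C * L * r + 1 + 2 * L / μ) * (Λ * e) * e := by
    have : θ k ≤ C * L * r := hθk.trans (by gcongr)
    gcongr
  rw [Real.norm_of_nonneg (by positivity), div_mul_eq_mul_div, le_div_iff₀ (by positivity)]
  nlinarith

end IsTail

end NewtonMR

/-! ### Identification and convergence -/

theorem corollary1 {d : ℕ} (f : EuclideanSpace ℝ (Fin d) → ℝ) (hf : ContDiff ℝ 2 f)
    (Lg : ℝ) (hLg : 0 ≤ Lg)
    (hgrad : ∀ x ∈ NewtonMR.orthant d, ∀ y ∈ NewtonMR.orthant d,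
      ‖gradient f x - gradient f y‖ ≤ Lg * ‖x - y‖)
    (xs : EuclideanSpace ℝ (Fin d)) (hxs : xs ∈ NewtonMR.orthant d)
    (hmin : IsLocalMinOn f (NewtonMR.orthant d) xs)
    (hnd : NewtonMR.Nondegenerate f xs) (hso : NewtonMR.SecondOrderSufficient f xs)
    (δ : ℝ) (hδ : 0 < δ) (hδxs : ∀ i ∈ NewtonMR.inactive xs 0, δ < 1 / 2 * xs i)
    (ρ : ℝ) (hρ : 0 < ρ) (hρ' : ρ < 1 / 2) (ζ : ℝ) (hζ : 0 < ζ) (hζ' : ζ < 1)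
    (I : Finset (Fin d)) (hI : I = NewtonMR.inactive xs 0) :
    IsLocalMin (NewtonMR.restrictTo f I) (NewtonMR.subvec I xs) ∧
    ∃ Δ : ℝ, 0 < Δ ∧
      ∀ (test : ℕ → NewtonMR.InnerTest d) (K : ℕ∞) (x p : ℕ → EuclideanSpace ℝ (Fin d))
        (D : ℕ → NewtonMR.StepType) (α : ℕ → ℝ) (kbar : ℕ),
      NewtonMR.IsLocalPhaseRun f ρ ζ δ test K x p D α →
      (kbar : ℕ∞) ≤ K → x kbar ∈ Metric.ball xs Δ →
      -- the active set is identified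
      (∀ k : ℕ, kbar + 1 ≤ k → (k : ℕ∞) ≤ K →
        NewtonMR.active (x k) δ = NewtonMR.active xs 0 ∧
        NewtonMR.active (x k) 0 = NewtonMR.active xs 0 ∧
        x k = NewtonMR.pad I (NewtonMR.subvec I (x k))) ∧
      -- the method is unconstrained Newton-MR on the inactive coordinates
      (∀ k : ℕ, kbar + 1 ≤ k → (k : ℕ∞) < K →
        D k = NewtonMR.StepType.SOL ∧
        NewtonMR.IsNewtonMRStep (NewtonMR.restrictTo f I) ρ ζ (test k I)
          (NewtonMR.subvec I (x k)) (NewtonMR.subvec I (p k)) (D k) (α k)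
          (NewtonMR.subvec I (x (k + 1)))) ∧
      -- local convergence
      (K = ⊤ → ∀ η : ℕ → ℝ, (∀ k, 0 ≤ η k) →
        -- relative residual test, tolerances bounded away from one
        (∀ ηbar : ℝ, ηbar < 1 → (∀ k, test k = NewtonMR.relativeTest (η k)) →
          (∀ᶠ k in atTop, η k ≤ ηbar) →
          Tendsto x atTop (𝓝 xs) ∧ (∀ᶠ k in atTop, α k = 1) ∧
          ∀ ηhat : ℝ, ηbar < ηhat → ∀ᶠ k in atTop,
            ‖NewtonMR.submat I (NewtonMR.hessian f xs) (NewtonMR.subvec I (x (k + 1) - xs))‖ ≤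
              ηhat *
                ‖NewtonMR.submat I (NewtonMR.hessian f xs) (NewtonMR.subvec I (x k - xs))‖) ∧
        -- normal-equation residual test, bounded tolerances
        (∀ M : ℝ, (∀ k, test k = NewtonMR.normalTest (η k)) →
          (∀ᶠ k in atTop, η k ≤ M) →
          Tendsto x atTop (𝓝 xs) ∧ (∀ᶠ k in atTop, α k = 1) ∧
          ∃ q : ℝ, q < 1 ∧ ∀ᶠ k in atTop,
            ‖NewtonMR.submat I (NewtonMR.hessian f xs) (NewtonMR.subvec I (x (k + 1) - xs))‖ ≤
              q * ‖NewtonMR.submat I (NewtonMR.hessian f xs) (NewtonMR.subvec I (x k - xs))‖) ∧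
        -- superlinear convergence
        ((∀ k, test k = NewtonMR.relativeTest (η k)) ∨
            (∀ k, test k = NewtonMR.normalTest (η k)) →
          Tendsto η atTop (𝓝 0) →
          Tendsto x atTop (𝓝 xs) ∧
          (fun k => x (k + 1) - xs) =o[atTop] (fun k => x k - xs)) ∧
        -- quadratic convergence
        (((∀ k, test k = NewtonMR.relativeTest (η k)) ∧
              ∃ ηbar : ℝ, ηbar < 1 ∧ ∀ᶠ k in atTop, η k ≤ ηbar) ∨
            (∀ k, test k = NewtonMR.normalTest (η k)) →
          η =O[atTop] (fun k => ‖NewtonMR.subvec I (gradient f (x k))‖) →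
          (∃ LH ε : ℝ, 0 < ε ∧
            ∀ y ∈ NewtonMR.orthant d ∩ Metric.ball xs ε,
            ∀ z ∈ NewtonMR.orthant d ∩ Metric.ball xs ε,
              ‖NewtonMR.hessian f y - NewtonMR.hessian f z‖ ≤ LH * ‖y - z‖) →
          Tendsto x atTop (𝓝 xs) ∧
          (fun k => x (k + 1) - xs) =O[atTop] (fun k => ‖x k - xs‖ ^ 2))) := by
  subst hI
  refine ⟨NewtonMR.isLocalMin_restrictTo hxs hmin, ?_⟩
  obtain ⟨μ, L, c, ε, R, r, M⟩ :=
    NewtonMR.exists_localModel hf hxs hmin hnd hso hδ hδxs hρ hρ'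
  obtain ⟨Δ, hΔ, hΔM⟩ := M.exists_ball_trapped
  refine ⟨Δ, hΔ, ?_⟩
  intro test K x p D α kbar hrun hK hball
  set I := NewtonMR.inactive xs 0
  have horth : ∀ k : ℕ, (k : ℕ∞) ≤ K → x k ∈ NewtonMR.orthant d := by
    rintro (_ | k) hk
    · exact hrun.start
    · rw [(hrun.step k (NewtonMR.coe_lt_of_succ_le hk)).2.2.2]
      exact NewtonMR.proj_mem_orthant _
  have htrap : ∀ k : ℕ, kbar ≤ k → (k : ℕ∞) ≤ K → M.Trapped (x k) := by
    intro k hk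
    induction k, hk using Nat.le_induction with
    | base => exact fun _ => hΔM _ (horth kbar hK) hball
    | succ k _ ih =>
      intro hkK
      have hlt := NewtonMR.coe_lt_of_succ_le hkK
      exact ((ih hlt.le).step (hrun.step k hlt)).1
  have hzero : ∀ k : ℕ, kbar + 1 ≤ k → (k : ℕ∞) ≤ K → ∀ i ∉ I, x k i = 0 := by
    rintro (_ | k) hk hkK
    · omega
    · have hlt := NewtonMR.coe_lt_of_succ_le hkK
      exact ((htrap k (by omega) hlt.le).step (hrun.step k hlt)).2
  have hactxs := M.active_zero_eq M.center_mem M.apply_eq_zero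
  refine ⟨?_, ?_, ?_⟩
  · intro k hk hkK
    have ht := htrap k (by omega) hkK
    have hb := M.ball_subset ht.mem_ball
    rw [hactxs]
    exact ⟨M.active_eq hb ht.mem_orthant, M.active_zero_eq hb (hzero k hk hkK),
      (NewtonMR.pad_subvec (hzero k hk hkK)).symm⟩
  · intro k hk hkK
    have ht := htrap k (by omega) hkK.le
    have hb := M.ball_subset ht.mem_ball
    exact ⟨((M.step ht.mem_ball ht.mem_orthant (hrun.step k hkK)).1.of_coercive M.mu_pos
      (M.coercive_hessian hb) M.L_pos (M.norm_submat_hessian_le hb)).1,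
      ht.isNewtonMRStep (hzero k hk hkK.le) (hrun.step k hkK)⟩
  rintro rfl η hη
  have htrap' : ∀ k ≥ kbar + 1, M.Trapped (x k) := fun k hk => htrap k (by omega) le_top
  have hzero' : ∀ k ≥ kbar + 1, ∀ i ∉ I, x k i = 0 := fun k hk => hzero k hk le_top
  have hstep := fun k (hk : kbar + 1 ≤ k) => M.step (htrap' k hk).mem_ball
    (htrap' k hk).mem_orthant (hrun.step k (ENat.natCast_lt_top k))
  have hmr := fun k (hk : kbar + 1 ≤ k) => (hstep k hk).1.of_coercive M.mu_pos
    (M.coercive_hessian (M.ball_subset (htrap' k hk).mem_ball)) M.L_pos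
    (M.norm_submat_hessian_le (M.ball_subset (htrap' k hk).mem_ball))
  have T : NewtonMR.IsTail f xs ρ I μ L r x (fun k => NewtonMR.subvec I (p k)) (kbar + 1) :=
    { mem_orthant := fun k hk => (htrap' k hk).mem_orthant
      mem_ball := fun k hk => (htrap' k hk).mem_ball
      eq_zero := hzero'
      next_eq := fun k hk => (hstep k hk).2.2.1
      norm_le := fun k hk => (hstep k hk).2.2.2.1
      decrease := fun k hk => by
        have h1 := (hstep k hk).2.2.2.2
        have h2 := (hmr k hk).2.2.1
        have h3 := M.coercive_hessian (M.ball_subset (htrap' k hk).mem_ball)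
          (NewtonMR.subvec I (p k))
        have h4 := mul_le_mul_of_nonneg_left (h2.trans (neg_le_neg h3)) hρ.le
        linarith }
  have hα : ∀ᶠ k in atTop, α k = 1 := by
    filter_upwards [eventually_ge_atTop (kbar + 1)] with k hk using (hstep k hk).2.1
  set s := fun k => NewtonMR.subvec I (p k)
  -- the inexact Newton conditions that the two inner tests provide
  have hrel : (∀ k, test k = NewtonMR.relativeTest (η k)) →
      ∀ᶠ k in atTop, NewtonMR.IsTail.Forcing f I x s k (η k) := by
    intro ht
    filter_upwards [eventually_ge_atTop (kbar + 1)] with k hk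
    have h := (hmr k hk).2.1
    rw [ht k] at h
    exact h
  have hnorm : (∀ k, test k = NewtonMR.normalTest (η k)) →
      ∀ᶠ k in atTop, NewtonMR.IsTail.Forcing f I x s k (√(1 - (μ / L) ^ 2)) ∧
        NewtonMR.IsTail.Forcing f I x s k (2 / μ * η k) := by
    intro ht
    filter_upwards [eventually_ge_atTop (kbar + 1)] with k hk
    have hco := M.coercive_hessian (M.ball_subset (htrap' k hk).mem_ball)
    obtain ⟨-, h, -, h1, h2⟩ := hmr k hk
    rw [ht k] at h
    exact ⟨NewtonMR.norm_residual_le_of_normalTest M.mu_pos hco h h2,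
      NewtonMR.norm_residual_le_mul_of_normalTest M.mu_pos hco (hη k) h h1⟩
  have hsqrt : √(1 - (μ / L) ^ 2) < 1 := by
    rw [Real.sqrt_lt' one_pos]
    have := M.mu_pos
    have := M.L_pos
    have : 0 < (μ / L) ^ 2 := by positivity
    linarith
  have htend_rel : (∀ k, test k = NewtonMR.relativeTest (η k)) → ∀ ηbar : ℝ, ηbar < 1 →
      (∀ᶠ k in atTop, η k ≤ ηbar) →
      (∀ᶠ k in atTop, NewtonMR.IsTail.Forcing f I x s k ηbar) ∧ Tendsto x atTop (𝓝 xs) := by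
    intro ht ηbar h1 h2
    have hF : ∀ᶠ k in atTop, NewtonMR.IsTail.Forcing f I x s k ηbar := by
      filter_upwards [hrel ht, h2] with k h3 h4
      exact h3.mono h4
    exact ⟨hF, T.tendsto M h1 hF⟩
  have htend_norm : (∀ k, test k = NewtonMR.normalTest (η k)) → Tendsto x atTop (𝓝 xs) :=
    fun ht => T.tendsto M hsqrt ((hnorm ht).mono fun k h => h.1)
  have hμη : ∀ k, 0 ≤ 2 / μ * η k := fun k => by
    have := M.mu_pos
    have := hη k
    positivity
  refine ⟨?_, ?_, ?_, ?_⟩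
  · intro ηbar hηbar ht hle
    obtain ⟨hF, hx⟩ := htend_rel ht ηbar hηbar hle
    obtain ⟨k, hk⟩ := hle.exists
    exact ⟨hx, hα, fun q hq => T.linear_rate M hx ((hη k).trans hk) hq hF⟩
  · intro _ ht _
    have hx := htend_norm ht
    obtain ⟨q, hq, hq1⟩ := exists_between hsqrt
    exact ⟨hx, hα, q, hq1, T.linear_rate M hx (Real.sqrt_nonneg _) hq
      ((hnorm ht).mono fun k h => h.1)⟩
  · rintro (ht | ht) hlim
    · have hx := (htend_rel ht (1 / 2) (by norm_num)
        ((hlim.eventually (gt_mem_nhds (show (0 : ℝ) < 1 / 2 by norm_num))).mono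
          fun k h => h.le)).2
      exact ⟨hx, T.superlinear_rate M hx hη hlim (hrel ht)⟩
    · have hx := htend_norm ht
      exact ⟨hx, T.superlinear_rate M hx hμη (by simpa using hlim.const_mul (2 / μ))
        ((hnorm ht).mono fun k h => h.2)⟩
  · rintro (⟨ht, ηbar, h1, h2⟩ | ht) hbig ⟨LH, τ, hτ, hLip⟩
    · have hx := (htend_rel ht ηbar h1 h2).2
      exact ⟨hx, T.quadratic_rate M hx hη hbig (hrel ht) hxs hτ hLip⟩
    · have hx := htend_norm ht
      exact ⟨hx, T.quadratic_rate M hx hμη (hbig.const_mul_left (2 / μ))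
        ((hnorm ht).mono fun k h => h.2) hxs hτ hLip⟩
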